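/- All objects are over $\mathbb{Q}$ and $\mathbb Z$-graded, and differentials have degree $+1$. A commutative DGA $B$ is *formal* if it is connected by a finite zigzag of quasi-isomorphisms of commutative DGAs to its cohomology algebra $H^\bullet(B)$ with zero differential. Put $B^+=\bigoplus_{i>0}B^i$. A class in $H^\bullet(B)$ is *decomposable* if it is a product $ab$ with $a\in H^i(B)$, $b\in H^j(B)$ and $i,j>0$. An *MC-product data* $\lambda$ consists of a central extension $0\to Z\to\widetilde L\xrightarrow{\pi}L\to 0$ of nilpotent differential graded Lie algebras concentrated in nonpositive degrees, with $Z\subset\ker \tilde d_L$ and $\operatorname{im}\tilde d_L\cap Z=0$ (where $\tilde d_L$ is the differential of $\widetilde L$), together with an isomorphism of $Z$ with a copy of $\mathbb{Q}$ placed in a degree $q\le 0$; let $z\in Z$ correspond to $1$. For a differential graded Lie algebra $M$, the tensor product $B\otimes M$ carries $$d(b\otimes w)=db\otimes w+(-1)^{|b|}b\otimes dw,\qquad [b_1\otimes w_1,b_2\otimes w_2]=(-1)^{|w_1||b_2|}b_1b_2\otimes[w_1,w_2],$$ and we write $F(\alpha)=d\alpha+\tfrac12[\alpha,\alpha]$.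 A *defining system* is an element $\alpha\in B^+\otimes L$ of degree $1$ with $F(\alpha)=0$. If $\tilde\alpha\in B^+\otimes\widetilde L$ is a lift of $\alpha$ of degree $1$, then $F(\tilde\alpha)=c\otimes z$ for a cocycle $c\in B^+$ whose class $m(\alpha)=[c]\in H^{2-q}(B)$ depends only on $\alpha$. Let $MP_\lambda(B)\subset H^\bullet(B)$ be the set of all classes $m(\alpha)$, where $\alpha$ runs through the defining systems. **Lemma.** Let $B$ be a formal commutative DGA. Then for every MC-product data $\lambda$, every element of $MP_\lambda(B)$ is a finite sum of decomposable classes in $H^\bullet(B)$. -/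

import Mathlib

open scoped TensorProduct DirectSum

universe u v

noncomputable section

/-! ## Graded vector spaces over `ℚ` -/

/-- The linear map of a graded vector space `M` sending a homogeneous element `m` to
`(-1) ^ |m| • m`. -/
def signMap {M : Type*} [AddCommGroup M] [Module ℚ M] (𝓜 : ℤ → Submodule ℚ M)
    [DirectSum.Decomposition 𝓜] : M →ₗ[ℚ] M :=
  (DirectSum.toModule ℚ ℤ M fun i => ((-1 : ℚ) ^ i) • (𝓜 i).subtype) ∘ₗ
    (DirectSum.decomposeLinearEquiv 𝓜).toLinearMap

theorem signMap_apply_of_mem {M : Type*} [AddCommGroup M] [Module ℚ M]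
    (𝓜 : ℤ → Submodule ℚ M) [DirectSum.Decomposition 𝓜] {i : ℤ} {m : M} (hm : m ∈ 𝓜 i) :
    signMap 𝓜 m = ((-1 : ℚ) ^ i) • m := by
  simp only [signMap, LinearMap.comp_apply, LinearEquiv.coe_coe,
    DirectSum.decomposeLinearEquiv_apply, DirectSum.decompose_of_mem 𝓜 hm]
  erw [DirectSum.toModule_lof]
  simp

/-- The projection of a graded vector space onto its part of even degree. -/
def evenPart {M : Type*} [AddCommGroup M] [Module ℚ M] (𝓜 : ℤ → Submodule ℚ M)
    [DirectSum.Decomposition 𝓜] : M →ₗ[ℚ] M :=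
  (1 / 2 : ℚ) • (LinearMap.id + signMap 𝓜)

/-- The projection of a graded vector space onto its part of odd degree. -/
def oddPart {M : Type*} [AddCommGroup M] [Module ℚ M] (𝓜 : ℤ → Submodule ℚ M)
    [DirectSum.Decomposition 𝓜] : M →ₗ[ℚ] M :=
  (1 / 2 : ℚ) • (LinearMap.id - signMap 𝓜)

/-! ## Commutative DGAs -/

/-- A (unital, `ℤ`-graded) commutative differential graded algebra over `ℚ`, with a differential
of degree `+1`. -/
structure CDGA where
  /-- the underlying vector space `⨁ i, A ^ i` -/
  carrier : Type u
  [ring : Ring carrier]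
  [algebra : Algebra ℚ carrier]
  /-- the homogeneous component `A ^ i` -/
  grade : ℤ → Submodule ℚ carrier
  [graded : GradedAlgebra grade]
  mul_comm' : ∀ {i j : ℤ} {a b : carrier}, a ∈ grade i → b ∈ grade j →
    a * b = ((-1 : ℚ) ^ (i * j)) • (b * a)
  /-- the differential -/
  d : carrier →ₗ[ℚ] carrier
  d_mem : ∀ {i : ℤ} {a : carrier}, a ∈ grade i → d a ∈ grade (i + 1)
  d_d : ∀ a : carrier, d (d a) = 0
  leibniz : ∀ {i : ℤ} {a : carrier}, a ∈ grade i → ∀ b : carrier,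
    d (a * b) = d a * b + ((-1 : ℚ) ^ i) • (a * d b)

namespace CDGA

attribute [instance] CDGA.ring CDGA.algebra CDGA.graded

instance : CoeSort CDGA.{u} (Type u) := ⟨CDGA.carrier⟩

variable (A : CDGA.{u})

theorem leibniz_sign (a b : A) : A.d (a * b) = A.d a * b + signMap A.grade a * A.d b := by
  induction a using DirectSum.Decomposition.inductionOn A.grade with
  | zero => simp
  | homogeneous m => rw [A.leibniz m.2, signMap_apply_of_mem A.grade m.2, smul_mul_assoc]
  | add m m' h h' => simp only [add_mul, map_add, h, h']; abel

theorem signMap_signMap (a : A) : signMap A.grade (signMap A.grade a) = a := by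
  induction a using DirectSum.Decomposition.inductionOn A.grade with
  | zero => simp
  | @homogeneous i m =>
    rw [signMap_apply_of_mem A.grade m.2, map_smul, signMap_apply_of_mem A.grade m.2, smul_smul,
      ← mul_zpow]
    simp
  | add m m' h h' => simp only [map_add, h, h']

theorem d_signMap (a : A) : A.d (signMap A.grade a) = -signMap A.grade (A.d a) := by
  induction a using DirectSum.Decomposition.inductionOn A.grade with
  | zero => simp
  | @homogeneous i m =>
    rw [signMap_apply_of_mem A.grade m.2, map_smul, signMap_apply_of_mem A.grade (A.d_mem m.2),
      zpow_add₀ (by norm_num)]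
    simp
  | add m m' h h' => simp only [map_add, h, h', neg_add]

theorem d_one : A.d 1 = 0 := by
  have h := A.leibniz (SetLike.GradedOne.one_mem : (1 : A) ∈ A.grade 0) 1
  simpa using h

theorem d_proj (i : ℤ) (a : A) :
    A.d (GradedAlgebra.proj A.grade i a) = GradedAlgebra.proj A.grade (i + 1) (A.d a) := by
  induction a using DirectSum.Decomposition.inductionOn A.grade with
  | zero => simp
  | @homogeneous j m =>
    simp only [GradedAlgebra.proj_apply]
    by_cases h : j = i
    · subst h
      rw [DirectSum.decompose_of_mem_same _ m.2, DirectSum.decompose_of_mem_same _ (A.d_mem m.2)]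
    · rw [DirectSum.decompose_of_mem_ne _ m.2 h,
        DirectSum.decompose_of_mem_ne _ (A.d_mem m.2) (by simpa using h), map_zero]
  | add m m' h h' => simp only [map_add, h, h']

/-- The algebra `ker d` of cocycles. -/
def cocycles : Subalgebra ℚ A where
  carrier := {a | A.d a = 0}
  mul_mem' := by
    intro a b ha hb
    simp only [Set.mem_ofPred_eq] at ha hb ⊢
    rw [A.leibniz_sign, ha, hb]; simp
  add_mem' := by
    intro a b ha hb
    simp only [Set.mem_ofPred_eq] at ha hb ⊢
    rw [map_add, ha, hb, add_zero]
  algebraMap_mem' := by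
    intro r
    simp only [Set.mem_ofPred_eq, Algebra.algebraMap_eq_smul_one, map_smul, A.d_one, smul_zero]

theorem mem_cocycles {a : A} : a ∈ A.cocycles ↔ A.d a = 0 := Iff.rfl

/-- The two-sided ideal `im d` of coboundaries in the algebra of cocycles. -/
def coboundaries : Ideal A.cocycles where
  carrier := {z | ∃ b : A, A.d b = z}
  zero_mem' := ⟨0, by simp⟩
  add_mem' := by
    rintro _ _ ⟨b, hb⟩ ⟨b', hb'⟩
    exact ⟨b + b', by simp [hb, hb']⟩
  smul_mem' := by
    rintro c _ ⟨b, hb⟩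
    refine ⟨signMap A.grade c * b, ?_⟩
    have hc : A.d c = 0 := c.2
    rw [A.leibniz_sign, A.d_signMap, hc, A.signMap_signMap, hb]
    simp

theorem mem_coboundaries {z : A.cocycles} : z ∈ A.coboundaries ↔ ∃ b : A, A.d b = z := Iff.rfl

instance : A.coboundaries.IsTwoSided where
  mul_mem_of_left := by
    rintro _ c ⟨b, hb⟩
    refine ⟨b * c, ?_⟩
    have hc : A.d c = 0 := c.2
    rw [A.leibniz_sign, hc, hb]
    simp

/-- The cohomology algebra `H(A) = ker d / im d`. -/
abbrev Cohomology : Type u := A.cocycles ⧸ A.coboundaries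

/-- The cohomology class of a cocycle. -/
def cohClass : A.cocycles →ₐ[ℚ] A.Cohomology := Ideal.Quotient.mkₐ ℚ A.coboundaries

theorem cohClass_surjective : Function.Surjective A.cohClass :=
  Ideal.Quotient.mkₐ_surjective ℚ A.coboundaries

theorem cohClass_eq_zero {z : A.cocycles} : A.cohClass z = 0 ↔ ∃ b : A, A.d b = z :=
  Ideal.Quotient.eq_zero_iff_mem

/-- The space `H ^ i (A)` of classes of cocycles of degree `i`. -/
def cohGrade (i : ℤ) : Submodule ℚ A.Cohomology :=
  ((A.grade i).comap A.cocycles.val.toLinearMap).map A.cohClass.toLinearMap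

theorem mem_cohGrade {i : ℤ} {x : A.Cohomology} :
    x ∈ A.cohGrade i ↔ ∃ z : A.cocycles, (z : A) ∈ A.grade i ∧ A.cohClass z = x := Iff.rfl

theorem cohGrade_isInternal : DirectSum.IsInternal A.cohGrade := by
  classical
  rw [DirectSum.isInternal_submodule_iff_iSupIndep_and_iSup_eq_top]
  have hcomp : ∀ (z : A.cocycles) (i : ℤ), GradedAlgebra.proj A.grade i (z : A) ∈ A.cocycles := by
    intro z i
    rw [mem_cocycles, A.d_proj, show A.d z = 0 from z.2, map_zero]
  constructor
  · intro i
    rw [Submodule.disjoint_def]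
    rintro _ ⟨z, hz, rfl⟩ hx
    have hz' : (z : A) ∈ A.grade i := hz
    have key : ∀ y ∈ ⨆ (j : ℤ) (_ : j ≠ i), A.cohGrade j,
        ∃ w : A.cocycles, A.cohClass w = y ∧ GradedAlgebra.proj A.grade i (w : A) = 0 := by
      intro y hy
      rw [iSup_subtype'] at hy
      induction hy using Submodule.iSup_induction' with
      | mem j y hy =>
        obtain ⟨w, hw, rfl⟩ := hy
        exact ⟨w, rfl, by
          rw [GradedAlgebra.proj_apply]
          exact DirectSum.decompose_of_mem_ne A.grade hw j.2⟩
      | zero => exact ⟨0, by simp, by simp⟩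
      | add y y' _ _ h h' =>
        obtain ⟨w, rfl, h1⟩ := h
        obtain ⟨w', rfl, h2⟩ := h'
        exact ⟨w + w', by simp, by rw [AddMemClass.coe_add, map_add, h1, h2, add_zero]⟩
    obtain ⟨w, hw, hw0⟩ := key _ hx
    have h0 : A.cohClass (z - w) = 0 := by rw [map_sub, hw]; simp
    obtain ⟨b, hb⟩ := A.cohClass_eq_zero.1 h0
    change A.cohClass z = 0
    refine A.cohClass_eq_zero.2 ⟨GradedAlgebra.proj A.grade (i - 1) b, ?_⟩
    rw [A.d_proj, hb, sub_add_cancel]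
    simp only [AddSubgroupClass.coe_sub, map_sub, hw0, sub_zero]
    rw [GradedAlgebra.proj_apply]
    exact DirectSum.decompose_of_mem_same A.grade hz'
  · rw [eq_top_iff]
    intro x _
    obtain ⟨z, rfl⟩ := A.cohClass_surjective x
    have hsum : z = ∑ i ∈ (DirectSum.decompose A.grade (z : A)).support,
        (⟨GradedAlgebra.proj A.grade i (z : A), hcomp z i⟩ : A.cocycles) := by
      apply Subtype.ext
      rw [AddSubmonoidClass.coe_finsetSum]
      exact (DirectSum.sum_support_decompose A.grade (z : A)).symm
    rw [hsum, map_sum]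
    refine Submodule.sum_mem _ fun i _ => Submodule.mem_iSup_of_mem i ?_
    exact ⟨_, SetLike.coe_mem (DirectSum.decompose A.grade (z : A) i), rfl⟩

instance cohGradedAlgebra : GradedAlgebra A.cohGrade where
  one_mem := ⟨1, SetLike.GradedOne.one_mem (A := A.grade), map_one A.cohClass⟩
  mul_mem := by
    rintro i j _ _ ⟨a, ha, rfl⟩ ⟨b, hb, rfl⟩
    exact ⟨a * b, SetLike.GradedMul.mul_mem (A := A.grade) ha hb, map_mul A.cohClass a b⟩
  toDecomposition := A.cohGrade_isInternal.chooseDecomposition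

/-- The cohomology algebra `H(A)`, regarded as a commutative DGA with zero differential. -/
def H : CDGA.{u} where
  carrier := A.Cohomology
  grade := A.cohGrade
  mul_comm' := by
    rintro i j _ _ ⟨a, ha, rfl⟩ ⟨b, hb, rfl⟩
    have h : a * b = ((-1 : ℚ) ^ (i * j)) • (b * a) := Subtype.ext (A.mul_comm' ha hb)
    change A.cohClass a * A.cohClass b = ((-1 : ℚ) ^ (i * j)) • (A.cohClass b * A.cohClass a)
    rw [← map_mul, h, map_smul, map_mul]
  d := 0
  d_mem := by intros; simp
  d_d := by intros; simp
  leibniz := by intros; simp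

/-- A morphism of commutative DGAs. -/
structure Hom (A B : CDGA.{u}) where
  toAlgHom : A →ₐ[ℚ] B
  map_mem : ∀ {i : ℤ} {a : A}, a ∈ A.grade i → toAlgHom a ∈ B.grade i
  map_d : ∀ a : A, toAlgHom (A.d a) = B.d (toAlgHom a)

/-- The restriction of a morphism of commutative DGAs to cocycles. -/
def Hom.mapCocycles {A B : CDGA.{u}} (f : Hom A B) : A.cocycles →ₐ[ℚ] B.cocycles :=
  (f.toAlgHom.comp A.cocycles.val).codRestrict B.cocycles fun z => by
    rw [mem_cocycles, AlgHom.comp_apply, ← f.map_d]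
    have hz : A.d z = 0 := z.2
    simp [hz]

/-- The map `H(A) → H(B)` induced by a morphism `A → B` of commutative DGAs. -/
def Hom.mapCohomology {A B : CDGA.{u}} (f : Hom A B) : A.Cohomology →ₐ[ℚ] B.Cohomology :=
  Ideal.Quotient.liftₐ A.coboundaries (B.cohClass.comp f.mapCocycles) (by
    rintro z ⟨b, hb⟩
    refine B.cohClass_eq_zero.2 ⟨f.toAlgHom b, ?_⟩
    rw [← f.map_d, hb]
    rfl)

theorem Hom.mapCohomology_cohClass {A B : CDGA.{u}} (f : Hom A B) (z : A.cocycles) :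
    f.mapCohomology (A.cohClass z) = B.cohClass (f.mapCocycles z) := rfl

/-- A morphism of commutative DGAs is a quasi-isomorphism if it induces an isomorphism in
cohomology. -/
def Hom.IsQuasiIso {A B : CDGA.{u}} (f : Hom A B) : Prop := Function.Bijective f.mapCohomology

/-- Two commutative DGAs are weakly equivalent if they are connected by a finite zigzag of
quasi-isomorphisms. -/
def WeaklyEquivalent : CDGA.{u} → CDGA.{u} → Prop :=
  Relation.EqvGen fun A B => ∃ f : Hom A B, f.IsQuasiIso

/-- A commutative DGA is formal if it is weakly equivalent to its cohomology algebra, regarded as a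
commutative DGA with zero differential. -/
def IsFormal : Prop := WeaklyEquivalent A A.H

/-- A decomposable class in `H(A)`: the product of two homogeneous classes of positive degree. -/
def IsDecomposable (x : A.Cohomology) : Prop :=
  ∃ i j : ℤ, 0 < i ∧ 0 < j ∧ ∃ a ∈ A.cohGrade i, ∃ b ∈ A.cohGrade j, x = a * b

end CDGA

/-! ## Differential graded Lie algebras -/

/-- A (`ℤ`-graded) differential graded Lie algebra over `ℚ`, with a differential of
degree `+1`. -/
structure DGLA where
  /-- the underlying vector space `⨁ i, L ^ i` -/
  carrier : Type v
  [addCommGroup : AddCommGroup carrier]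
  [module : Module ℚ carrier]
  /-- the homogeneous component `L ^ i` -/
  grade : ℤ → Submodule ℚ carrier
  [graded : DirectSum.Decomposition grade]
  /-- the Lie bracket -/
  bracket : carrier →ₗ[ℚ] carrier →ₗ[ℚ] carrier
  bracket_mem : ∀ {i j : ℤ} {x y : carrier}, x ∈ grade i → y ∈ grade j →
    bracket x y ∈ grade (i + j)
  bracket_skew : ∀ {i j : ℤ} {x y : carrier}, x ∈ grade i → y ∈ grade j →
    bracket x y = -((-1 : ℚ) ^ (i * j)) • bracket y x
  jacobi : ∀ {i j : ℤ} {x y : carrier}, x ∈ grade i → y ∈ grade j → ∀ z : carrier,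
    bracket x (bracket y z) =
      bracket (bracket x y) z + ((-1 : ℚ) ^ (i * j)) • bracket y (bracket x z)
  /-- the differential -/
  d : carrier →ₗ[ℚ] carrier
  d_mem : ∀ {i : ℤ} {x : carrier}, x ∈ grade i → d x ∈ grade (i + 1)
  d_d : ∀ x : carrier, d (d x) = 0
  leibniz : ∀ {i : ℤ} {x : carrier}, x ∈ grade i → ∀ y : carrier,
    d (bracket x y) = bracket (d x) y + ((-1 : ℚ) ^ i) • bracket x (d y)

namespace DGLA

attribute [instance] DGLA.addCommGroup DGLA.module DGLA.graded

instance : CoeSort DGLA.{v} (Type v) := ⟨DGLA.carrier⟩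

variable (L : DGLA.{v})

/-- The lower central series: `L, [L, L], [L, [L, L]], …`. -/
def lowerCentralSeries : ℕ → Submodule ℚ L
  | 0 => ⊤
  | n + 1 => Submodule.span ℚ {z | ∃ x : L, ∃ y ∈ lowerCentralSeries n, L.bracket x y = z}

/-- A DGLA is nilpotent if its lower central series terminates in `0`. -/
def IsNilpotent : Prop := ∃ n : ℕ, L.lowerCentralSeries n = ⊥

/-- A DGLA is concentrated in nonpositive degrees if `L ^ i = 0` for `i > 0`. -/
def IsNonpositive : Prop := ∀ i : ℤ, 0 < i → L.grade i = ⊥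

/-- A morphism of DGLAs. -/
structure Hom (L M : DGLA.{v}) where
  toLinearMap : L →ₗ[ℚ] M
  map_mem : ∀ {i : ℤ} {x : L}, x ∈ L.grade i → toLinearMap x ∈ M.grade i
  map_bracket : ∀ x y : L, toLinearMap (L.bracket x y) = M.bracket (toLinearMap x) (toLinearMap y)
  map_d : ∀ x : L, toLinearMap (L.d x) = M.d (toLinearMap x)

end DGLA

/-! ## The DGLA `A ⊗ L` -/

section Tensor

variable (A : CDGA.{u}) (L : DGLA.{v})

/-- The differential of `A ⊗ L`: `d (b ⊗ w) = d b ⊗ w + (-1) ^ |b| • b ⊗ d w`. -/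
def tensorD : A ⊗[ℚ] L →ₗ[ℚ] A ⊗[ℚ] L :=
  TensorProduct.map A.d LinearMap.id + TensorProduct.map (signMap A.grade) L.d

/-- The bracket of `A ⊗ L`:
`[b₁ ⊗ w₁, b₂ ⊗ w₂] = (-1) ^ (|w₁| * |b₂|) • (b₁ * b₂) ⊗ [w₁, w₂]`.
The sign is `1` when `w₁` has even degree, and `(-1) ^ |b₂|` when `w₁` has odd degree. -/
def tensorBracket : A ⊗[ℚ] L →ₗ[ℚ] A ⊗[ℚ] L →ₗ[ℚ] A ⊗[ℚ] L :=
  TensorProduct.map₂ (LinearMap.mul ℚ A) (L.bracket ∘ₗ evenPart L.grade) +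
    TensorProduct.map₂ ((LinearMap.mul ℚ A).compl₂ (signMap A.grade))
      (L.bracket ∘ₗ oddPart L.grade)

theorem tensorD_tmul {i : ℤ} {b : A} (hb : b ∈ A.grade i) (w : L) :
    tensorD A L (b ⊗ₜ[ℚ] w) = A.d b ⊗ₜ[ℚ] w + ((-1 : ℚ) ^ i) • (b ⊗ₜ[ℚ] L.d w) := by
  simp [tensorD, signMap_apply_of_mem A.grade hb, TensorProduct.smul_tmul']

theorem tensorBracket_tmul {i j : ℤ} (b₁ : A) {b₂ : A} {w₁ : L} (hw₁ : w₁ ∈ L.grade i)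
    (hb₂ : b₂ ∈ A.grade j) (w₂ : L) :
    tensorBracket A L (b₁ ⊗ₜ[ℚ] w₁) (b₂ ⊗ₜ[ℚ] w₂) =
      ((-1 : ℚ) ^ (i * j)) • ((b₁ * b₂) ⊗ₜ[ℚ] L.bracket w₁ w₂) := by
  rcases Int.even_or_odd i with hi | hi
  · have h1 : evenPart L.grade w₁ = w₁ := by
      simp only [evenPart, LinearMap.smul_apply, LinearMap.add_apply, LinearMap.id_apply,
        signMap_apply_of_mem L.grade hw₁, hi.neg_one_zpow]
      module
    have h2 : oddPart L.grade w₁ = 0 := by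
      simp [oddPart, signMap_apply_of_mem L.grade hw₁, hi.neg_one_zpow]
    simp [tensorBracket, h1, h2, (hi.mul_right j).neg_one_zpow]
  · have h1 : evenPart L.grade w₁ = 0 := by
      simp [evenPart, signMap_apply_of_mem L.grade hw₁, hi.neg_one_zpow]
    have h2 : oddPart L.grade w₁ = w₁ := by
      simp only [oddPart, LinearMap.smul_apply, LinearMap.sub_apply, LinearMap.id_apply,
        signMap_apply_of_mem L.grade hw₁, hi.neg_one_zpow]
      module
    have h3 : (-1 : ℚ) ^ (i * j) = (-1 : ℚ) ^ j := by rw [zpow_mul, hi.neg_one_zpow]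
    simp [tensorBracket, h1, h2, h3, signMap_apply_of_mem A.grade hb₂, TensorProduct.smul_tmul']

/-- The curvature `F(α) = d α + (1/2) [α, α]`. -/
def curvature (α : A ⊗[ℚ] L) : A ⊗[ℚ] L :=
  tensorD A L α + (1 / 2 : ℚ) • tensorBracket A L α α

/-- The part of degree `n` of `A⁺ ⊗ L`, where `A⁺ = ⨁_{i > 0} A ^ i`, as a subspace of `A ⊗ L`. -/
def plusTensorGrade (n : ℤ) : Submodule ℚ (A ⊗[ℚ] L) :=
  Submodule.span ℚ {t | ∃ i j : ℤ, 0 < i ∧ i + j = n ∧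
    ∃ a ∈ A.grade i, ∃ w ∈ L.grade j, a ⊗ₜ[ℚ] w = t}

/-- `α` is a Maurer–Cartan element of `A⁺ ⊗ L`. -/
def IsPlusMaurerCartan (α : A ⊗[ℚ] L) : Prop :=
  α ∈ plusTensorGrade A L 1 ∧ curvature A L α = 0

end Tensor

/-! ## MC higher products -/

/-- An MC-product data: a central extension `0 → Z → Ltot → L → 0` of nilpotent DGLAs concentrated
in nonpositive degrees, where `Z` is the kernel of the surjection `π`, such that `Z ⊆ ker d` and
`im d ∩ Z = 0`, together with an isomorphism of `Z` with a copy of `ℚ` placed in degree `q`. -/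
structure MCProductData where
  Ltot : DGLA.{v}
  L : DGLA.{v}
  Ltot_nilpotent : Ltot.IsNilpotent
  L_nilpotent : L.IsNilpotent
  Ltot_nonpositive : Ltot.IsNonpositive
  L_nonpositive : L.IsNonpositive
  π : DGLA.Hom Ltot L
  π_surjective : Function.Surjective π.toLinearMap
  central : ∀ z ∈ LinearMap.ker π.toLinearMap, ∀ x : Ltot, Ltot.bracket z x = 0
  d_center : ∀ z ∈ LinearMap.ker π.toLinearMap, Ltot.d z = 0
  range_d_inf_center : LinearMap.range Ltot.d ⊓ LinearMap.ker π.toLinearMap = ⊥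
  q : ℤ
  q_nonpos : q ≤ 0
  centerEquiv : ℚ ≃ₗ[ℚ] LinearMap.ker π.toLinearMap
  centerEquiv_mem : ∀ r : ℚ, (centerEquiv r : Ltot) ∈ Ltot.grade q

namespace MCProductData

variable (D : MCProductData.{v}) (A : CDGA.{u})

/-- The generator of the centre `Z` corresponding to `1 : ℚ`. -/
def gen : D.Ltot := (D.centerEquiv 1 : D.Ltot)

/-- A defining system with respect to an MC-product data: a Maurer–Cartan element of `A⁺ ⊗ L`. -/
def IsDefiningSystem (α : A ⊗[ℚ] D.L) : Prop := IsPlusMaurerCartan A D.L α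

/-- `x` is the MC higher product `m(α)` of `α`: for a lift `β` of `α` to a degree one element of
`A⁺ ⊗ Ltot`, the curvature `F(β)`, which lies in `A⁺ ⊗ Z ≅ A⁺`, corresponds to a cocycle `c` whose
class is `x`. -/
def IsHigherProduct (α : A ⊗[ℚ] D.L) (x : A.Cohomology) : Prop :=
  ∃ β ∈ plusTensorGrade A D.Ltot 1, TensorProduct.map LinearMap.id D.π.toLinearMap β = α ∧
    ∃ c : A.cocycles, curvature A D.Ltot β = (c : A) ⊗ₜ[ℚ] D.gen ∧ A.cohClass c = x

/-- The set `MP(A)` of all MC higher products in `H(A)` with respect to an MC-product data. -/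
def MP : Set A.Cohomology :=
  {x | ∃ α : A ⊗[ℚ] D.L, D.IsDefiningSystem A α ∧ D.IsHigherProduct A α x}

end MCProductData

end

/-!
The property that all MC higher products of `A` with respect to a fixed MC-product data are finite
sums of decomposable classes (`MCProductData.ProductsDecompose`) holds when `A` has zero
differential, and is invariant under quasi-isomorphisms in both directions; a formal algebra
therefore has it.

*Zero differential* (`productsDecompose_of_d_eq_zero`). If `F(β) = c ⊗ z`, then a linear functional
which vanishes on the boundaries of the total Lie algebra but not on `z` exists because
`im d ∩ Z = 0`; applied to the second factor it kills `dβ`, and so expresses `c` through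
`(1/2) [β, β]`, that is, through products of coefficients of `β`, which have positive degree.

*Invariance*. A class is an MC higher product exactly when some `β` of degree one over the total
Lie algebra has curvature `c ⊗ z`, with `c` a representative (`mem_MP_iff`). Hence MC higher products
push forward along morphisms, and the property passes from the target of a quasi-isomorphism to its
source (`ProductsDecompose.of_quasiIso`). Along a surjective quasi-isomorphism `p`, they also lift
(`exists_lift_of_curvature`): `ker p` has a contraction `s` of degree `-1`, and, by the Bianchi
identity, subtracting `s ⊗ id` applied to the error `F(α) - ζ` from a lift `α` improves it by one
step of the lower central series, which is finite. An arbitrary quasi-isomorphism `A → B` is replaced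
by a surjective one by means of the mapping path object `A ×_B B[t, dt]`
(`CDGA.Hom.IsQuasiIso.exists_surjective`), whose projection to `A` is a quasi-isomorphism by the
Poincaré lemma for polynomial forms on the line.
-/

/-! ### Graded vector spaces -/

theorem neg_one_zpow_congr {m n : ℤ} (h : Even m ↔ Even n) : (-1 : ℚ) ^ m = (-1 : ℚ) ^ n := by
  simp [neg_one_zpow_eq_ite, h]

section Graded

variable {M : Type*} [AddCommGroup M] [Module ℚ M] (𝓜 : ℤ → Submodule ℚ M)
  [DirectSum.Decomposition 𝓜]
variable {N : Type*} [AddCommGroup N] [Module ℚ N] (𝓝 : ℤ → Submodule ℚ N)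
  [DirectSum.Decomposition 𝓝]

/-- The projection of a graded vector space onto its part of degree `i`, as an endomorphism. -/
noncomputable def homProj (i : ℤ) : M →ₗ[ℚ] M :=
  (𝓜 i).subtype ∘ₗ DirectSum.component ℚ ℤ (fun j => 𝓜 j) i ∘ₗ
    (DirectSum.decomposeLinearEquiv 𝓜).toLinearMap

theorem homProj_apply (i : ℤ) (x : M) : homProj 𝓜 i x = (DirectSum.decompose 𝓜 x i : M) := rfl

theorem homProj_mem (i : ℤ) (x : M) : homProj 𝓜 i x ∈ 𝓜 i := SetLike.coe_mem _

theorem homProj_of_mem {i : ℤ} {x : M} (hx : x ∈ 𝓜 i) : homProj 𝓜 i x = x :=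
  DirectSum.decompose_of_mem_same 𝓜 hx

theorem homProj_of_mem_ne {i j : ℤ} {x : M} (hx : x ∈ 𝓜 j) (h : j ≠ i) : homProj 𝓜 i x = 0 :=
  DirectSum.decompose_of_mem_ne 𝓜 hx h

theorem sum_homProj_of_support_subset [DecidableEq M] {x : M} {s : Finset ℤ}
    (hs : (DirectSum.decompose 𝓜 x).support ⊆ s) : ∑ i ∈ s, homProj 𝓜 i x = x := by
  conv_rhs => rw [← DirectSum.sum_support_decompose 𝓜 x]
  refine (Finset.sum_subset hs fun i _ hi => ?_).symm
  rw [DFinsupp.notMem_support_iff] at hi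
  rw [homProj_apply, hi]; rfl

theorem exists_sum_homProj (x : M) : ∃ s : Finset ℤ, ∑ i ∈ s, homProj 𝓜 i x = x := by
  classical
  exact ⟨_, sum_homProj_of_support_subset 𝓜 subset_rfl⟩

/-- A linear map which is homogeneous of degree `k` intertwines the projections onto the
homogeneous components. -/
theorem map_homProj_add {f : M →ₗ[ℚ] N} {k : ℤ} (hf : ∀ i, ∀ x ∈ 𝓜 i, f x ∈ 𝓝 (i + k)) (i : ℤ)
    (x : M) : f (homProj 𝓜 i x) = homProj 𝓝 (i + k) (f x) := by
  induction x using DirectSum.Decomposition.inductionOn 𝓜 with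
  | zero => simp
  | @homogeneous j m =>
    by_cases h : j = i
    · subst h
      rw [homProj_of_mem 𝓜 m.2, homProj_of_mem 𝓝 (hf _ _ m.2)]
    · rw [homProj_of_mem_ne 𝓜 m.2 h, homProj_of_mem_ne 𝓝 (hf _ _ m.2) (by simpa using h), map_zero]
  | add m m' h h' => simp only [map_add, h, h']

theorem map_homProj {f : M →ₗ[ℚ] N} (hf : ∀ i, ∀ x ∈ 𝓜 i, f x ∈ 𝓝 i) (i : ℤ)
    (x : M) : f (homProj 𝓜 i x) = homProj 𝓝 i (f x) := by
  simpa using map_homProj_add 𝓜 𝓝 (f := f) (k := 0) (by simpa using hf) i x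

theorem map_signMap {f : M →ₗ[ℚ] N} (hf : ∀ i, ∀ x ∈ 𝓜 i, f x ∈ 𝓝 i) (x : M) :
    f (signMap 𝓜 x) = signMap 𝓝 (f x) := by
  induction x using DirectSum.Decomposition.inductionOn 𝓜 with
  | zero => simp
  | homogeneous m =>
    rw [signMap_apply_of_mem 𝓜 m.2, signMap_apply_of_mem 𝓝 (hf _ _ m.2), map_smul]
  | add m m' h h' => simp only [map_add, h, h']

/-- A family of subspaces spanning the whole space is a grading as soon as it admits a compatible
family of projections. -/
theorem isInternal_of_projections {M : Type*} [AddCommGroup M] [Module ℚ M]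
    (𝓜 : ℤ → Submodule ℚ M) (P : ℤ → M →ₗ[ℚ] M)
    (hself : ∀ i, ∀ x ∈ 𝓜 i, P i x = x) (hne : ∀ i j, j ≠ i → ∀ x ∈ 𝓜 j, P i x = 0)
    (hsup : ∀ x, x ∈ ⨆ i, 𝓜 i) : DirectSum.IsInternal 𝓜 := by
  rw [DirectSum.isInternal_submodule_iff_iSupIndep_and_iSup_eq_top]
  refine ⟨fun i => ?_, eq_top_iff.2 fun x _ => hsup x⟩
  rw [Submodule.disjoint_def]
  intro x hx hx'
  have hle : ⨆ (j : ℤ) (_ : j ≠ i), 𝓜 j ≤ LinearMap.ker (P i) :=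
    iSup₂_le fun j hj y hy => hne i j hj y hy
  rw [← hself i x hx]
  exact hle hx'

end Graded

theorem CDGA.signMap_mul (A : CDGA.{u}) (a b : A) :
    signMap A.grade (a * b) = signMap A.grade a * signMap A.grade b := by
  induction a using DirectSum.Decomposition.inductionOn A.grade with
  | zero => simp
  | @homogeneous i m =>
    induction b using DirectSum.Decomposition.inductionOn A.grade with
    | zero => simp
    | @homogeneous j m' =>
      rw [signMap_apply_of_mem A.grade m.2, signMap_apply_of_mem A.grade m'.2,
        signMap_apply_of_mem A.grade (SetLike.GradedMul.mul_mem m.2 m'.2),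
        zpow_add₀ (by norm_num), smul_mul_smul_comm]
    | add m m' h h' => simp only [mul_add, map_add, h, h']
  | add m m' h h' => simp only [add_mul, map_add, h, h']

theorem CDGA.signMap_one (A : CDGA.{u}) : signMap A.grade (1 : A) = 1 := by
  rw [signMap_apply_of_mem A.grade (SetLike.GradedOne.one_mem : (1 : A) ∈ A.grade 0)]
  simp

/-! ### The differential graded Lie algebra `A ⊗ L` -/

section TensorLie

variable (A : CDGA.{u}) (L : DGLA.{v})

/-- The part of total degree `n` of `A ⊗ L`. -/
def tensorGrade (n : ℤ) : Submodule ℚ (A ⊗[ℚ] L) :=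
  Submodule.span ℚ {t | ∃ i j : ℤ, i + j = n ∧ ∃ a ∈ A.grade i, ∃ w ∈ L.grade j, a ⊗ₜ[ℚ] w = t}

theorem plusTensorGrade_le (n : ℤ) : plusTensorGrade A L n ≤ tensorGrade A L n :=
  Submodule.span_mono fun _ ⟨i, j, _, h, h'⟩ => ⟨i, j, h, h'⟩

variable {A L}

theorem tmul_mem_plusTensorGrade {i j : ℤ} (hi : 0 < i) {a : A} (ha : a ∈ A.grade i) {w : L}
    (hw : w ∈ L.grade j) : a ⊗ₜ[ℚ] w ∈ plusTensorGrade A L (i + j) :=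
  Submodule.subset_span ⟨i, j, hi, rfl, a, ha, w, hw, rfl⟩

/-- Pure tensors of homogeneous elements span `A ⊗ L`. -/
@[elab_as_elim]
theorem tensor_homogeneous_induction {motive : A ⊗[ℚ] L → Prop} (zero : motive 0)
    (add : ∀ x y, motive x → motive y → motive (x + y))
    (tmul : ∀ (i j : ℤ) (a : A) (w : L), a ∈ A.grade i → w ∈ L.grade j → motive (a ⊗ₜ[ℚ] w))
    (x : A ⊗[ℚ] L) : motive x := by
  induction x using TensorProduct.induction_on with
  | zero => exact zero
  | add x y hx hy => exact add x y hx hy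
  | tmul a w =>
    induction a using DirectSum.Decomposition.inductionOn A.grade with
    | zero => simpa using zero
    | add a a' ha ha' => rw [TensorProduct.add_tmul]; exact add _ _ ha ha'
    | homogeneous a =>
      induction w using DirectSum.Decomposition.inductionOn L.grade with
      | zero => simpa using zero
      | add w w' hw hw' => rw [TensorProduct.tmul_add]; exact add _ _ hw hw'
      | homogeneous w => exact tmul _ _ _ _ a.2 w.2

variable (A L)

theorem tensorD_tensorD (x : A ⊗[ℚ] L) : tensorD A L (tensorD A L x) = 0 := by
  induction x using tensor_homogeneous_induction with
  | zero => simp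
  | add x y hx hy => simp only [map_add, hx, hy, add_zero]
  | tmul i j a w ha hw =>
    rw [tensorD_tmul A L ha, map_add, map_smul, tensorD_tmul A L (A.d_mem ha),
      tensorD_tmul A L ha, A.d_d, L.d_d, zpow_add₀ (by norm_num)]
    simp only [TensorProduct.zero_tmul, TensorProduct.tmul_zero, zpow_one]
    module

variable {A L}

theorem tensorBracket_skew {m n : ℤ} {x y : A ⊗[ℚ] L} (hx : x ∈ tensorGrade A L m)
    (hy : y ∈ tensorGrade A L n) :
    tensorBracket A L x y = -((-1 : ℚ) ^ (m * n)) • tensorBracket A L y x := by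
  induction hx using Submodule.span_induction with
  | zero => simp
  | add x x' _ _ h h' => simp only [map_add, LinearMap.add_apply, h, h', smul_add]
  | smul r x _ h => simp only [map_smul, LinearMap.smul_apply, h]; rw [smul_comm]
  | mem x hx =>
    obtain ⟨i, j, rfl, a, ha, w, hw, rfl⟩ := hx
    induction hy using Submodule.span_induction with
    | zero => simp
    | add x x' _ _ h h' => simp only [map_add, LinearMap.add_apply, h, h', smul_add]
    | smul r x _ h => simp only [map_smul, LinearMap.smul_apply, h]; rw [smul_comm]
    | mem y hy =>
      obtain ⟨i', j', rfl, a', ha', w', hw', rfl⟩ := hy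
      rw [tensorBracket_tmul A L a hw ha', tensorBracket_tmul A L a' hw' ha, A.mul_comm' ha ha',
        L.bracket_skew hw hw']
      simp only [neg_smul, TensorProduct.tmul_neg, TensorProduct.tmul_smul,
        ← TensorProduct.smul_tmul', smul_smul, smul_neg, neg_mul]
      simp only [← zpow_add₀ (show (-1 : ℚ) ≠ 0 by norm_num)]
      congr 2
      apply neg_one_zpow_congr
      simp only [Int.even_add, Int.even_mul]
      tauto

theorem tensorD_tensorBracket {m : ℤ} {x : A ⊗[ℚ] L} (hx : x ∈ tensorGrade A L m)
    (y : A ⊗[ℚ] L) :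
    tensorD A L (tensorBracket A L x y) = tensorBracket A L (tensorD A L x) y +
      ((-1 : ℚ) ^ m) • tensorBracket A L x (tensorD A L y) := by
  induction hx using Submodule.span_induction with
  | zero => simp
  | add x x' _ _ h h' => simp only [map_add, LinearMap.add_apply, h, h', smul_add]; abel
  | smul r x _ h =>
    simp only [map_smul, LinearMap.smul_apply, h, smul_add]
    congr 1
    exact smul_comm _ _ _
  | mem x hx =>
    obtain ⟨i, j, rfl, a, ha, w, hw, rfl⟩ := hx
    induction y using tensor_homogeneous_induction with
    | zero => simp
    | add x x' h h' => simp only [map_add, h, h', smul_add]; abel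
    | tmul i' j' a' w' ha' hw' =>
      rw [tensorBracket_tmul A L a hw ha', map_smul,
        tensorD_tmul A L (SetLike.GradedMul.mul_mem ha ha'), tensorD_tmul A L ha,
        tensorD_tmul A L ha', A.leibniz ha, L.leibniz hw]
      simp only [map_add, map_smul, LinearMap.add_apply, LinearMap.smul_apply]
      rw [tensorBracket_tmul A L _ hw ha', tensorBracket_tmul A L _ (L.d_mem hw) ha',
        tensorBracket_tmul A L _ hw (A.d_mem ha'), tensorBracket_tmul A L _ hw ha']
      simp only [TensorProduct.tmul_add, TensorProduct.add_tmul, TensorProduct.tmul_smul,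
        ← TensorProduct.smul_tmul', smul_smul, smul_add]
      simp only [← zpow_add₀ (show (-1 : ℚ) ≠ 0 by norm_num)]
      -- it remains to match the four terms on both sides and to compare the parities of their signs
      have e : ∀ p q r s s' t t' : ℤ, ∀ X Y Z W : A ⊗[ℚ] L, (Even q ↔ Even t) →
          (Even r ↔ Even s) → (Even s' ↔ Even t') →
          (-1 : ℚ) ^ p • X + (-1 : ℚ) ^ q • Y + ((-1 : ℚ) ^ r • Z + (-1 : ℚ) ^ s' • W) =
          (-1 : ℚ) ^ p • X + (-1 : ℚ) ^ s • Z + ((-1 : ℚ) ^ t • Y + (-1 : ℚ) ^ t' • W) := by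
        intro p q r s s' t t' X Y Z W h1 h2 h3
        rw [neg_one_zpow_congr h1, neg_one_zpow_congr h2, neg_one_zpow_congr h3]
        abel
      apply e <;> simp only [Int.even_add, Int.even_mul, Int.not_even_one] <;> tauto

theorem tensorBracket_jacobi {m n : ℤ} {x y : A ⊗[ℚ] L} (hx : x ∈ tensorGrade A L m)
    (hy : y ∈ tensorGrade A L n) (z : A ⊗[ℚ] L) :
    tensorBracket A L x (tensorBracket A L y z) = tensorBracket A L (tensorBracket A L x y) z +
      ((-1 : ℚ) ^ (m * n)) • tensorBracket A L y (tensorBracket A L x z) := by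
  induction hx using Submodule.span_induction with
  | zero => simp
  | add x x' _ _ h h' => simp only [map_add, LinearMap.add_apply, h, h', smul_add]; abel
  | smul r x _ h =>
    simp only [map_smul, LinearMap.smul_apply, h, smul_add]
    congr 1
    exact smul_comm _ _ _
  | mem x hx =>
    obtain ⟨i, j, rfl, a, ha, w, hw, rfl⟩ := hx
    induction hy using Submodule.span_induction with
    | zero => simp
    | add x x' _ _ h h' => simp only [map_add, LinearMap.add_apply, h, h', smul_add]; abel
    | smul r x _ h =>
      simp only [map_smul, LinearMap.smul_apply, h, smul_add]
      congr 1
      exact smul_comm _ _ _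
    | mem y hy =>
      obtain ⟨i', j', rfl, a', ha', w', hw', rfl⟩ := hy
      induction z using tensor_homogeneous_induction with
      | zero => simp
      | add x x' h h' => simp only [map_add, h, h', smul_add]; abel
      | tmul k l b v hb hv =>
        rw [tensorBracket_tmul A L a' hw' hb, tensorBracket_tmul A L a hw ha',
          tensorBracket_tmul A L a hw hb]
        simp only [map_smul, LinearMap.smul_apply]
        rw [tensorBracket_tmul A L _ hw (SetLike.GradedMul.mul_mem ha' hb),
          tensorBracket_tmul A L _ hw' (SetLike.GradedMul.mul_mem ha hb),
          tensorBracket_tmul A L _ (L.bracket_mem hw hw') hb, L.jacobi hw hw' v,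
          ← mul_assoc, ← mul_assoc, A.mul_comm' ha' ha]
        simp only [TensorProduct.tmul_add, TensorProduct.tmul_smul, smul_mul_assoc,
          ← TensorProduct.smul_tmul', smul_smul, smul_add]
        simp only [← zpow_add₀ (show (-1 : ℚ) ≠ 0 by norm_num)]
        congr 2 <;> apply neg_one_zpow_congr <;>
          simp only [Int.even_add, Int.even_mul] <;> grind

theorem tensorBracket_mem_plusTensorGrade {m n : ℤ} {x y : A ⊗[ℚ] L}
    (hx : x ∈ plusTensorGrade A L m) (hy : y ∈ plusTensorGrade A L n) :
    tensorBracket A L x y ∈ plusTensorGrade A L (m + n) := by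
  induction hx using Submodule.span_induction with
  | zero => simp
  | add x x' _ _ h h' => rw [map_add, LinearMap.add_apply]; exact Submodule.add_mem _ h h'
  | smul r x _ h => rw [map_smul, LinearMap.smul_apply]; exact Submodule.smul_mem _ r h
  | mem x hx =>
    obtain ⟨i, j, hi, rfl, a, ha, w, hw, rfl⟩ := hx
    induction hy using Submodule.span_induction with
    | zero => simp
    | add x x' _ _ h h' => rw [map_add]; exact Submodule.add_mem _ h h'
    | smul r x _ h => rw [map_smul]; exact Submodule.smul_mem _ r h
    | mem y hy =>
      obtain ⟨i', j', hi', rfl, a', ha', w', hw', rfl⟩ := hy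
      rw [tensorBracket_tmul A L a hw ha']
      refine Submodule.smul_mem _ _ ?_
      rw [add_add_add_comm]
      exact tmul_mem_plusTensorGrade (by omega) (SetLike.GradedMul.mul_mem ha ha')
        (L.bracket_mem hw hw')

theorem tensorD_mem_plusTensorGrade {m : ℤ} {x : A ⊗[ℚ] L} (hx : x ∈ plusTensorGrade A L m) :
    tensorD A L x ∈ plusTensorGrade A L (m + 1) := by
  induction hx using Submodule.span_induction with
  | zero => simp
  | add x x' _ _ h h' => rw [map_add]; exact Submodule.add_mem _ h h'
  | smul r x _ h => rw [map_smul]; exact Submodule.smul_mem _ r h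
  | mem x hx =>
    obtain ⟨i, j, hi, rfl, a, ha, w, hw, rfl⟩ := hx
    rw [tensorD_tmul A L ha]
    refine Submodule.add_mem _ ?_ (Submodule.smul_mem _ _ ?_)
    · rw [add_right_comm]
      exact tmul_mem_plusTensorGrade (by omega) (A.d_mem ha) hw
    · rw [add_assoc]
      exact tmul_mem_plusTensorGrade hi ha (L.d_mem hw)

theorem curvature_mem_plusTensorGrade {x : A ⊗[ℚ] L} (hx : x ∈ plusTensorGrade A L 1) :
    curvature A L x ∈ plusTensorGrade A L (1 + 1) :=
  Submodule.add_mem _ (tensorD_mem_plusTensorGrade hx)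
    (Submodule.smul_mem _ _ (tensorBracket_mem_plusTensorGrade hx hx))

theorem tensorBracket_comm_of_degree_one {x y : A ⊗[ℚ] L} (hx : x ∈ tensorGrade A L 1)
    (hy : y ∈ tensorGrade A L 1) : tensorBracket A L x y = tensorBracket A L y x := by
  simpa using tensorBracket_skew hx hy

theorem curvature_add {x y : A ⊗[ℚ] L} (hx : x ∈ tensorGrade A L 1) (hy : y ∈ tensorGrade A L 1) :
    curvature A L (x + y) = curvature A L x + tensorD A L y + tensorBracket A L x y +
      (1 / 2 : ℚ) • tensorBracket A L y y := by
  simp only [curvature, map_add, LinearMap.add_apply, tensorBracket_comm_of_degree_one hy hx]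
  module

/-- The Bianchi identity `d F(α) + [α, F(α)] = 0`. -/
theorem tensorD_curvature {x : A ⊗[ℚ] L} (hx : x ∈ plusTensorGrade A L 1) :
    tensorD A L (curvature A L x) = -tensorBracket A L x (curvature A L x) := by
  have hx1 := plusTensorGrade_le A L 1 hx
  have hD := plusTensorGrade_le A L (1 + 1) (tensorD_mem_plusTensorGrade hx)
  have hxx := plusTensorGrade_le A L (1 + 1) (tensorBracket_mem_plusTensorGrade hx hx)
  have h1 := tensorD_tensorBracket hx1 x
  have h2 := tensorBracket_skew hD hx1
  have h3 := tensorBracket_jacobi hx1 hx1 x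
  have h4 := tensorBracket_skew hxx hx1
  simp only [mul_one, zpow_one, one_add_one_eq_two, even_two,
    Even.neg_one_zpow] at h1 h2 h3 h4
  -- the Jacobi identity reads `3 [x, [x, x]] = 0`
  have h5 : tensorBracket A L x (tensorBracket A L x x) = 0 := by
    rw [h4] at h3
    have h3' := sub_eq_zero.2 h3
    rw [show ∀ t : A ⊗[ℚ] L, t - ((-1 : ℚ) • t + (-1 : ℚ) • t) = (3 : ℚ) • t from
      fun t => by module] at h3'
    exact (smul_eq_zero.1 h3').resolve_left (by norm_num)
  simp only [curvature, map_add, map_smul, h1, h2, h5, tensorD_tensorD]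
  module

end TensorLie

/-! ### Functoriality -/

namespace CDGA

/-- The identity morphism of a commutative DGA. -/
def Hom.id (A : CDGA.{u}) : Hom A A where
  toAlgHom := AlgHom.id ℚ A
  map_mem h := h
  map_d _ := rfl

variable {A B : CDGA.{u}} (f : Hom A B)

theorem Hom.map_signMap (a : A) : f.toAlgHom (signMap A.grade a) = signMap B.grade (f.toAlgHom a) :=
  _root_.map_signMap A.grade B.grade (f := f.toAlgHom.toLinearMap) (fun _ _ h => f.map_mem h) a

theorem Hom.map_homProj (i : ℤ) (a : A) :
    f.toAlgHom (homProj A.grade i a) = homProj B.grade i (f.toAlgHom a) :=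
  _root_.map_homProj A.grade B.grade (f := f.toAlgHom.toLinearMap) (fun _ _ h => f.map_mem h) i a

theorem d_homProj (i : ℤ) (a : A) : A.d (homProj A.grade i a) = homProj A.grade (i + 1) (A.d a) :=
  map_homProj_add A.grade A.grade (fun _ _ h => A.d_mem h) i a

theorem Hom.exists_homogeneous_preimage (hf : Function.Surjective f.toAlgHom) {i : ℤ} {b : B}
    (hb : b ∈ B.grade i) : ∃ a ∈ A.grade i, f.toAlgHom a = b := by
  obtain ⟨a, rfl⟩ := hf b
  exact ⟨homProj A.grade i a, homProj_mem _ _ _, by rw [f.map_homProj, homProj_of_mem _ hb]⟩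

theorem Hom.mapCohomology_mem {i : ℤ} {x : A.Cohomology} (hx : x ∈ A.cohGrade i) :
    f.mapCohomology x ∈ B.cohGrade i := by
  obtain ⟨z, hz, rfl⟩ := hx
  exact ⟨f.mapCocycles z, f.map_mem hz, rfl⟩

theorem Hom.mapCohomology_homProj (i : ℤ) (x : A.Cohomology) :
    f.mapCohomology (homProj A.cohGrade i x) = homProj B.cohGrade i (f.mapCohomology x) :=
  _root_.map_homProj A.cohGrade B.cohGrade (f := f.mapCohomology.toLinearMap)
    (fun _ _ h => f.mapCohomology_mem h) i x

variable (A) in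
/-- The finite sums of decomposable classes in `H(A)`. -/
def decomposables : AddSubmonoid A.Cohomology := AddSubmonoid.closure {x | A.IsDecomposable x}

theorem Hom.mapCohomology_mem_decomposables {x : A.Cohomology} (hx : x ∈ A.decomposables) :
    f.mapCohomology x ∈ B.decomposables := by
  induction hx using AddSubmonoid.closure_induction with
  | zero => simp
  | add x y _ _ hx hy => rw [map_add]; exact add_mem hx hy
  | mem x hx =>
    obtain ⟨i, j, hi, hj, a, ha, b, hb, rfl⟩ := hx
    exact AddSubmonoid.subset_closure ⟨i, j, hi, hj, _, f.mapCohomology_mem ha, _,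
      f.mapCohomology_mem hb, map_mul _ _ _⟩

theorem Hom.IsQuasiIso.mem_decomposables {f : Hom A B} (hf : f.IsQuasiIso) {x : A.Cohomology}
    (hx : f.mapCohomology x ∈ B.decomposables) : x ∈ A.decomposables := by
  have hle : B.decomposables ≤ A.decomposables.map (f.mapCohomology : A.Cohomology →+ B.Cohomology)
      := by
    refine AddSubmonoid.closure_le.2 ?_
    rintro _ ⟨i, j, hi, hj, a, ha, b, hb, rfl⟩
    have lift : ∀ k, ∀ y ∈ B.cohGrade k, ∃ y' ∈ A.cohGrade k, f.mapCohomology y' = y := by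
      intro k y hy
      obtain ⟨y', rfl⟩ := hf.2 y
      exact ⟨homProj A.cohGrade k y', homProj_mem _ _ _,
        by rw [f.mapCohomology_homProj, homProj_of_mem _ hy]⟩
    obtain ⟨a', ha', rfl⟩ := lift i a ha
    obtain ⟨b', hb', rfl⟩ := lift j b hb
    exact ⟨a' * b', AddSubmonoid.subset_closure ⟨i, j, hi, hj, a', ha', b', hb', rfl⟩,
      map_mul f.mapCohomology _ _⟩
  obtain ⟨x', hx', h⟩ := hle hx
  rwa [← hf.1 h]

end CDGA

/-- The identity morphism of a DGLA. -/
def DGLA.Hom.id (L : DGLA.{v}) : DGLA.Hom L L where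
  toLinearMap := LinearMap.id
  map_mem h := h
  map_bracket _ _ := rfl
  map_d _ := rfl

section TensorHom

variable {A B : CDGA.{u}} {L M : DGLA.{v}} (f : CDGA.Hom A B) (g : DGLA.Hom L M)

/-- The map `A ⊗ L → B ⊗ M` induced by morphisms `A → B` and `L → M`. -/
noncomputable def tensorHom : A ⊗[ℚ] L →ₗ[ℚ] B ⊗[ℚ] M :=
  TensorProduct.map f.toAlgHom.toLinearMap g.toLinearMap

theorem tensorHom_tmul (a : A) (w : L) :
    tensorHom f g (a ⊗ₜ[ℚ] w) = f.toAlgHom a ⊗ₜ[ℚ] g.toLinearMap w := rfl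

theorem tensorHom_tensorD (x : A ⊗[ℚ] L) :
    tensorHom f g (tensorD A L x) = tensorD B M (tensorHom f g x) := by
  induction x using tensor_homogeneous_induction with
  | zero => simp
  | add x y hx hy => simp only [map_add, hx, hy]
  | tmul i j a w ha hw =>
    simp only [tensorD_tmul A L ha, tensorHom_tmul, tensorD_tmul B M (f.map_mem ha), map_add,
      map_smul, f.map_d, g.map_d]

theorem tensorHom_tensorBracket (x y : A ⊗[ℚ] L) :
    tensorHom f g (tensorBracket A L x y) =
      tensorBracket B M (tensorHom f g x) (tensorHom f g y) := by
  induction x using tensor_homogeneous_induction with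
  | zero => simp
  | add x y hx hy => simp only [map_add, LinearMap.add_apply, hx, hy]
  | tmul i j a w ha hw =>
    induction y using tensor_homogeneous_induction with
    | zero => simp
    | add x y hx hy => simp only [map_add, hx, hy]
    | tmul i' j' a' w' ha' hw' =>
      rw [tensorBracket_tmul A L a hw ha', map_smul, tensorHom_tmul, tensorHom_tmul, tensorHom_tmul,
        tensorBracket_tmul B M _ (g.map_mem hw) (f.map_mem ha'), map_mul, g.map_bracket]

theorem tensorHom_curvature (x : A ⊗[ℚ] L) :
    tensorHom f g (curvature A L x) = curvature B M (tensorHom f g x) := by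
  simp only [curvature, map_add, map_smul, tensorHom_tensorD, tensorHom_tensorBracket]

theorem tensorHom_mem_plusTensorGrade {n : ℤ} {x : A ⊗[ℚ] L} (hx : x ∈ plusTensorGrade A L n) :
    tensorHom f g x ∈ plusTensorGrade B M n := by
  induction hx using Submodule.span_induction with
  | zero => simp
  | add x x' _ _ h h' => rw [map_add]; exact Submodule.add_mem _ h h'
  | smul r x _ h => rw [map_smul]; exact Submodule.smul_mem _ r h
  | mem x hx =>
    obtain ⟨i, j, hi, rfl, a, ha, w, hw, rfl⟩ := hx
    exact tmul_mem_plusTensorGrade hi (f.map_mem ha) (g.map_mem hw)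

theorem exists_tensorHom_eq_of_surjective (hf : Function.Surjective f.toAlgHom) {n : ℤ}
    {y : B ⊗[ℚ] L} (hy : y ∈ plusTensorGrade B L n) :
    ∃ x ∈ plusTensorGrade A L n, tensorHom f (DGLA.Hom.id L) x = y := by
  induction hy using Submodule.span_induction with
  | zero => exact ⟨0, Submodule.zero_mem _, map_zero _⟩
  | add y y' _ _ h h' =>
    obtain ⟨x, hx, rfl⟩ := h
    obtain ⟨x', hx', rfl⟩ := h'
    exact ⟨x + x', Submodule.add_mem _ hx hx', map_add _ _ _⟩
  | smul r y _ h =>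
    obtain ⟨x, hx, rfl⟩ := h
    exact ⟨r • x, Submodule.smul_mem _ r hx, map_smul _ _ _⟩
  | mem y hy =>
    obtain ⟨i, j, hi, rfl, b, hb, w, hw, rfl⟩ := hy
    obtain ⟨a, ha, rfl⟩ := f.exists_homogeneous_preimage hf hb
    exact ⟨a ⊗ₜ[ℚ] w, tmul_mem_plusTensorGrade hi ha hw, rfl⟩

end TensorHom

/-! ### MC higher products -/

namespace MCProductData

variable (D : MCProductData.{v}) {A B : CDGA.{u}}

theorem π_gen : D.π.toLinearMap D.gen = 0 := (D.centerEquiv 1).2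

theorem gen_ne_zero : D.gen ≠ 0 := by
  intro h
  have : D.centerEquiv 1 = 0 := Subtype.ext h
  simp at this

theorem gen_mem : D.gen ∈ D.Ltot.grade D.q := D.centerEquiv_mem 1

theorem d_gen : D.Ltot.d D.gen = 0 := D.d_center _ D.π_gen

theorem bracket_gen_right (x : D.Ltot) : D.Ltot.bracket x D.gen = 0 := by
  induction x using DirectSum.Decomposition.inductionOn D.Ltot.grade with
  | zero => simp
  | homogeneous m =>
    rw [D.Ltot.bracket_skew m.2 D.gen_mem, D.central _ D.π_gen, smul_zero]
  | add m m' h h' => simp only [map_add, LinearMap.add_apply, h, h', add_zero]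

/-- The defining system is determined by its lift, and the Maurer–Cartan equation follows from the
shape of the curvature of the lift. -/
theorem mem_MP_iff {x : A.Cohomology} : x ∈ D.MP A ↔ ∃ β ∈ plusTensorGrade A D.Ltot 1,
    ∃ c : A.cocycles, curvature A D.Ltot β = (c : A) ⊗ₜ[ℚ] D.gen ∧ A.cohClass c = x := by
  constructor
  · rintro ⟨α, -, β, hβ, -, c, hc⟩
    exact ⟨β, hβ, c, hc⟩
  · rintro ⟨β, hβ, c, hc, hx⟩
    refine ⟨tensorHom (CDGA.Hom.id A) D.π β,
      ⟨tensorHom_mem_plusTensorGrade _ _ hβ, ?_⟩, β, hβ, rfl, c, hc, hx⟩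
    rw [← tensorHom_curvature, hc, tensorHom_tmul, D.π_gen, TensorProduct.tmul_zero]

theorem mapCohomology_mem_MP (f : CDGA.Hom A B) {x : A.Cohomology} (hx : x ∈ D.MP A) :
    f.mapCohomology x ∈ D.MP B := by
  rw [mem_MP_iff] at hx ⊢
  obtain ⟨β, hβ, c, hc, rfl⟩ := hx
  refine ⟨tensorHom f (DGLA.Hom.id _) β, tensorHom_mem_plusTensorGrade _ _ hβ,
    f.mapCocycles c, ?_, rfl⟩
  rw [← tensorHom_curvature, hc]
  rfl

/-- All MC higher products in `H(A)` are finite sums of decomposable classes. -/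
def ProductsDecompose (A : CDGA.{u}) : Prop := ∀ x ∈ D.MP A, x ∈ A.decomposables

variable {D} in
theorem ProductsDecompose.of_quasiIso {f : CDGA.Hom A B} (hf : f.IsQuasiIso)
    (hB : D.ProductsDecompose B) : D.ProductsDecompose A := fun _ hx =>
  hf.mem_decomposables (hB _ (D.mapCohomology_mem_MP f hx))

/-! ### Vanishing differential -/

/-- If `A` has zero differential, a functional `φ` on the total Lie algebra which vanishes on
boundaries but not on the generator `z` of the centre recovers the class of `c`, up to a nonzero
scalar, from `c ⊗ z = F(β)` as `id ⊗ φ` applied to `(1/2) [β, β]`. -/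
theorem productsDecompose_of_d_eq_zero (hA : A.d = 0) : D.ProductsDecompose A := by
  intro x hx
  obtain ⟨β, hβ, c, hc, rfl⟩ := D.mem_MP_iff.1 hx
  have hgen : D.gen ∉ LinearMap.range D.Ltot.d := by
    intro h
    have h' : D.gen ∈ LinearMap.range D.Ltot.d ⊓ LinearMap.ker D.π.toLinearMap := ⟨h, D.π_gen⟩
    rw [D.range_d_inf_center] at h'
    exact D.gen_ne_zero h'
  obtain ⟨φ, hφ, hφd⟩ := Submodule.exists_le_ker_of_notMem hgen
  have hcoc : ∀ a : A, a ∈ A.cocycles := fun a => by rw [CDGA.mem_cocycles, hA]; rfl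
  -- `id ⊗ φ`, followed by the passage to cohomology classes
  let Φ : A ⊗[ℚ] D.Ltot →ₗ[ℚ] A.Cohomology :=
    (A.cohClass.toLinearMap ∘ₗ LinearMap.codRestrict (Subalgebra.toSubmodule A.cocycles)
      LinearMap.id hcoc) ∘ₗ (TensorProduct.rid ℚ A).toLinearMap ∘ₗ
      TensorProduct.map LinearMap.id φ
  have hΦ : ∀ (a : A) (w : D.Ltot), Φ (a ⊗ₜ[ℚ] w) = φ w • A.cohClass ⟨a, hcoc a⟩ := by
    intro a w
    have : Φ (a ⊗ₜ[ℚ] w) = A.cohClass ⟨φ w • a, hcoc _⟩ := rfl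
    rw [this, ← map_smul]
    rfl
  have hD : ∀ t, Φ (tensorD A D.Ltot t) = 0 := by
    intro t
    induction t using tensor_homogeneous_induction with
    | zero => simp
    | add x y hx hy => simp only [map_add, hx, hy, add_zero]
    | tmul i j a w ha hw =>
      have h0 : φ (D.Ltot.d w) = 0 := hφd ⟨w, rfl⟩
      rw [tensorD_tmul A D.Ltot ha, hA]
      simp [hΦ, h0]
  have hbr : ∀ s ∈ plusTensorGrade A D.Ltot 1, ∀ t ∈ plusTensorGrade A D.Ltot 1, ∀ r : ℚ,
      r • Φ (tensorBracket A D.Ltot s t) ∈ A.decomposables := by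
    intro s hs t ht
    induction hs using Submodule.span_induction with
    | zero => simp
    | add x x' _ _ h h' =>
      intro r
      rw [map_add, LinearMap.add_apply, map_add, smul_add]
      exact add_mem (h r) (h' r)
    | smul q x _ h =>
      intro r
      rw [map_smul, LinearMap.smul_apply, map_smul, smul_smul]
      exact h _
    | mem s hs =>
      obtain ⟨i, j, hi, -, a, ha, w, hw, rfl⟩ := hs
      induction ht using Submodule.span_induction with
      | zero => simp
      | add x x' _ _ h h' =>
        intro r
        rw [map_add, map_add, smul_add]
        exact add_mem (h r) (h' r)
      | smul q x _ h =>
        intro r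
        rw [map_smul, map_smul, smul_smul]
        exact h _
      | mem t ht =>
        obtain ⟨i', j', hi', -, a', ha', w', hw', rfl⟩ := ht
        intro r
        rw [tensorBracket_tmul A D.Ltot a hw ha', map_smul, hΦ, smul_smul, smul_smul]
        refine AddSubmonoid.subset_closure ⟨i, i', hi, hi',
          (r * (-1) ^ (j * i') * φ (D.Ltot.bracket w w')) • A.cohClass ⟨a, hcoc a⟩,
          Submodule.smul_mem _ _ ⟨⟨a, hcoc a⟩, ha, rfl⟩,
          A.cohClass ⟨a', hcoc a'⟩, ⟨⟨a', hcoc a'⟩, ha', rfl⟩, ?_⟩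
        rw [smul_mul_assoc, ← map_mul]
        rfl
  have key : φ D.gen • A.cohClass c = (1 / 2 : ℚ) • Φ (tensorBracket A D.Ltot β β) := by
    have := congrArg Φ hc
    rw [hΦ] at this
    rw [← map_smul Φ, ← zero_add (Φ _), ← hD β, ← map_add]
    exact this.symm
  rw [← inv_smul_smul₀ hφ (A.cohClass c), key, smul_smul]
  exact hbr β hβ β hβ _

end MCProductData

/-! ### Surjective quasi-isomorphisms -/

namespace CDGA

variable {C B : CDGA.{u}} {p : Hom C B}

/-- The kernel of a surjective quasi-isomorphism is acyclic. -/
theorem Hom.IsQuasiIso.exists_d_eq_of_map_eq_zero (hq : p.IsQuasiIso)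
    (hp : Function.Surjective p.toAlgHom) {a : C} (ha : p.toAlgHom a = 0) (hda : C.d a = 0) :
    ∃ e, p.toAlgHom e = 0 ∧ C.d e = a := by
  have h0 : C.cohClass ⟨a, hda⟩ = 0 := by
    apply hq.1
    rw [map_zero, p.mapCohomology_cohClass]
    exact B.cohClass_eq_zero.2 ⟨0, by rw [map_zero]; exact ha.symm⟩
  obtain ⟨e, he⟩ := C.cohClass_eq_zero.1 h0
  have he' : C.d e = a := he
  have hpe : B.d (p.toAlgHom e) = 0 := by rw [← p.map_d, he', ha]
  obtain ⟨y, hy⟩ := hq.2 (B.cohClass ⟨_, hpe⟩)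
  obtain ⟨z, rfl⟩ := C.cohClass_surjective y
  rw [p.mapCohomology_cohClass, ← sub_eq_zero, ← map_sub] at hy
  obtain ⟨b, hb⟩ := B.cohClass_eq_zero.1 hy
  obtain ⟨c, rfl⟩ := hp b
  have hz : C.d z = 0 := z.2
  have hb' : B.d (p.toAlgHom c) = p.toAlgHom z - p.toAlgHom e := hb
  refine ⟨e - z + C.d c, ?_, ?_⟩
  · rw [map_add, map_sub, p.map_d, hb']; abel
  · rw [map_add, map_sub, he', hz, C.d_d, sub_zero, add_zero]

/-- A surjective quasi-isomorphism is surjective on cocycles. More precisely, a cocycle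
representing the image of a class `y` lifts to a cocycle representing `y`, of the same degree. -/
theorem Hom.IsQuasiIso.exists_cocycle_lift (hq : p.IsQuasiIso)
    (hp : Function.Surjective p.toAlgHom) (y : C.Cohomology) {c : B.cocycles}
    (hc : B.cohClass c = p.mapCohomology y) {n : ℤ} (hcn : (c : B) ∈ B.grade n) :
    ∃ z : C.cocycles, (z : C) ∈ C.grade n ∧ p.toAlgHom z = c ∧ C.cohClass z = y := by
  obtain ⟨z, rfl⟩ := C.cohClass_surjective y
  rw [p.mapCohomology_cohClass, ← sub_eq_zero, ← map_sub] at hc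
  obtain ⟨b, hb⟩ := B.cohClass_eq_zero.1 hc
  obtain ⟨e, rfl⟩ := hp b
  have hb' : B.d (p.toAlgHom e) = c - p.toAlgHom z := hb
  have hz : C.d z = 0 := z.2
  have hz' : C.d (homProj C.grade n (z + C.d e)) = 0 := by
    rw [C.d_homProj, map_add, hz, C.d_d, add_zero, map_zero]
  have hpz : p.toAlgHom (homProj C.grade n (z + C.d e)) = c := by
    rw [p.map_homProj, map_add, p.map_d, hb', add_sub_cancel, homProj_of_mem _ hcn]
  refine ⟨⟨_, hz'⟩, homProj_mem _ _ _, hpz, hq.1 ?_⟩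
  rw [p.mapCohomology_cohClass, p.mapCohomology_cohClass, ← sub_eq_zero, ← map_sub]
  refine B.cohClass_eq_zero.2 ⟨p.toAlgHom e, ?_⟩
  rw [hb', ← hpz]
  rfl

/-- The kernel of a surjective quasi-isomorphism admits a contraction `s`, homogeneous of
degree `-1`, and defined on the whole algebra. -/
theorem Hom.IsQuasiIso.exists_contraction (hq : p.IsQuasiIso)
    (hp : Function.Surjective p.toAlgHom) : ∃ s : C →ₗ[ℚ] C,
      (∀ i, ∀ a ∈ C.grade i, s a ∈ C.grade (i - 1)) ∧ (∀ a, p.toAlgHom (s a) = 0) ∧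
      ∀ a, p.toAlgHom a = 0 → C.d (s a) + s (C.d a) = a := by
  let K : Submodule ℚ C := LinearMap.ker p.toAlgHom.toLinearMap
  have hK : ∀ a, a ∈ K ↔ p.toAlgHom a = 0 := fun a => Iff.rfl
  -- `τ` picks primitives in `K` of the cocycles of `K`
  obtain ⟨g, hg⟩ := (C.d ∘ₗ K.subtype).rangeRestrict.exists_rightInverse_of_surjective
    (LinearMap.range_rangeRestrict _)
  obtain ⟨τ, hτ⟩ := LinearMap.exists_extend g
  have hdτ : ∀ a ∈ K, C.d a = 0 → C.d (τ a) = a := by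
    intro a ha hda
    obtain ⟨e, he, rfl⟩ := hq.exists_d_eq_of_map_eq_zero hp ha hda
    have hmem : C.d e ∈ LinearMap.range (C.d ∘ₗ K.subtype) := ⟨⟨e, he⟩, rfl⟩
    have h1 : τ (C.d e) = g ⟨C.d e, hmem⟩ := LinearMap.congr_fun hτ ⟨C.d e, hmem⟩
    have h2 := congrArg Subtype.val (LinearMap.congr_fun hg ⟨C.d e, hmem⟩)
    rw [h1]
    exact h2
  let t : C →ₗ[ℚ] C := K.subtype ∘ₗ τ
  have htK : ∀ a, t a ∈ K := fun a => (τ a).2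
  have hdK : ∀ a ∈ K, C.d a ∈ K := fun a ha => by rw [hK] at ha ⊢; rw [p.map_d, ha, map_zero]
  -- `t' = t (1 - t d)` is a contraction of `K`, of no particular degree
  let t' : C →ₗ[ℚ] C := t ∘ₗ (LinearMap.id - t ∘ₗ C.d)
  have ht'K : ∀ a, t' a ∈ K := fun a => htK _
  have ht' : ∀ a ∈ K, C.d (t' a) + t' (C.d a) = a := by
    intro a ha
    have h1 : C.d (t (C.d a)) = C.d a := hdτ _ (hdK a ha) (C.d_d a)
    have h2 : C.d (t (a - t (C.d a))) = a - t (C.d a) :=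
      hdτ _ (K.sub_mem ha (htK _)) (by rw [map_sub, h1, sub_self])
    change C.d (t (a - t (C.d a))) + t (C.d a - t (C.d (C.d a))) = a
    rw [h2, C.d_d, map_zero, sub_zero, sub_add_cancel]
  -- its component of degree `-1`
  let s : C →ₗ[ℚ] C := (DirectSum.toModule ℚ ℤ C fun i =>
    homProj C.grade (i - 1) ∘ₗ t' ∘ₗ (C.grade i).subtype) ∘ₗ
      (DirectSum.decomposeLinearEquiv C.grade).toLinearMap
  have hs : ∀ i, ∀ a ∈ C.grade i, s a = homProj C.grade (i - 1) (t' a) := by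
    intro i a ha
    simp only [s, LinearMap.comp_apply, LinearEquiv.coe_coe,
      DirectSum.decomposeLinearEquiv_apply, DirectSum.decompose_of_mem C.grade ha]
    erw [DirectSum.toModule_lof]
    rfl
  refine ⟨s, fun i a ha => ?_, fun a => ?_, fun a ha => ?_⟩
  · rw [hs i a ha]; exact homProj_mem _ _ _
  · induction a using DirectSum.Decomposition.inductionOn C.grade with
    | zero => simp
    | homogeneous m => rw [hs _ _ m.2, p.map_homProj, (hK _).1 (ht'K _), map_zero]
    | add m m' h h' => simp only [map_add, h, h', add_zero]
  · obtain ⟨S, hS⟩ := exists_sum_homProj C.grade a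
    have key : ∀ i, C.d (s (homProj C.grade i a)) + s (C.d (homProj C.grade i a)) =
        homProj C.grade i a := by
      intro i
      have hm := homProj_mem C.grade i a
      have hk : homProj C.grade i a ∈ K := by rw [hK, p.map_homProj, ha, map_zero]
      rw [hs _ _ hm, hs _ _ (C.d_mem hm), C.d_homProj, sub_add_cancel, add_sub_cancel_right,
        ← map_add, ht' _ hk, homProj_of_mem _ hm]
    rw [← hS, map_sum, map_sum, map_sum, map_sum, ← Finset.sum_add_distrib]
    exact Finset.sum_congr rfl fun i _ => key i

end CDGA

section Lifting

variable {C B : CDGA.{u}} {L : DGLA.{v}}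

variable (C) in
/-- The subspace `C ⊗ N` of `C ⊗ L`, for a subspace `N` of `L`. -/
def tensorSubspace (N : Submodule ℚ L) : Submodule ℚ (C ⊗[ℚ] L) :=
  Submodule.span ℚ {t | ∃ a : C, ∃ w ∈ N, a ⊗ₜ[ℚ] w = t}

theorem mem_tensorSubspace_top (x : C ⊗[ℚ] L) : x ∈ tensorSubspace C (⊤ : Submodule ℚ L) := by
  induction x using TensorProduct.induction_on with
  | zero => exact Submodule.zero_mem _
  | add x y hx hy => exact Submodule.add_mem _ hx hy
  | tmul a w => exact Submodule.subset_span ⟨a, w, trivial, rfl⟩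

theorem eq_zero_of_mem_tensorSubspace_bot {x : C ⊗[ℚ] L}
    (hx : x ∈ tensorSubspace C (⊥ : Submodule ℚ L)) : x = 0 := by
  induction hx using Submodule.span_induction with
  | zero => rfl
  | add x y _ _ hx hy => rw [hx, hy, add_zero]
  | smul r x _ hx => rw [hx, smul_zero]
  | mem x hx =>
    obtain ⟨a, w, hw, rfl⟩ := hx
    rw [(Submodule.mem_bot ℚ).1 hw, TensorProduct.tmul_zero]

theorem tensorBracket_mem_tensorSubspace {n : ℕ} (x : C ⊗[ℚ] L) {y : C ⊗[ℚ] L}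
    (hy : y ∈ tensorSubspace C (L.lowerCentralSeries n)) :
    tensorBracket C L x y ∈ tensorSubspace C (L.lowerCentralSeries (n + 1)) := by
  have hbr : ∀ (b : C) (v : L), ∀ w ∈ L.lowerCentralSeries n,
      b ⊗ₜ[ℚ] L.bracket v w ∈ tensorSubspace C (L.lowerCentralSeries (n + 1)) :=
    fun b v w hw => Submodule.subset_span ⟨b, _, Submodule.subset_span ⟨v, w, hw, rfl⟩, rfl⟩
  induction hy using Submodule.span_induction with
  | zero => simp
  | add y y' _ _ h h' => rw [map_add]; exact Submodule.add_mem _ h h'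
  | smul r y _ h => rw [map_smul]; exact Submodule.smul_mem _ r h
  | mem y hy =>
    obtain ⟨a, w, hw, rfl⟩ := hy
    induction x using TensorProduct.induction_on with
    | zero => simp
    | add x x' h h' => rw [map_add, LinearMap.add_apply]; exact Submodule.add_mem _ h h'
    | tmul b v => exact Submodule.add_mem _ (hbr _ _ w hw) (hbr _ _ w hw)

theorem map_id_mem_tensorSubspace (s : C →ₗ[ℚ] C) {N : Submodule ℚ L} {x : C ⊗[ℚ] L}
    (hx : x ∈ tensorSubspace C N) :
    TensorProduct.map s LinearMap.id x ∈ tensorSubspace C N := by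
  induction hx using Submodule.span_induction with
  | zero => simp
  | add y y' _ _ h h' => rw [map_add]; exact Submodule.add_mem _ h h'
  | smul r y _ h => rw [map_smul]; exact Submodule.smul_mem _ r h
  | mem y hy =>
    obtain ⟨a, w, hw, rfl⟩ := hy
    exact Submodule.subset_span ⟨s a, w, hw, rfl⟩

theorem map_id_mem_plusTensorGrade {s : C →ₗ[ℚ] C}
    (hs : ∀ i, ∀ a ∈ C.grade i, s a ∈ C.grade (i - 1)) (hL : L.IsNonpositive) {x : C ⊗[ℚ] L}
    (hx : x ∈ plusTensorGrade C L (1 + 1)) :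
    TensorProduct.map s LinearMap.id x ∈ plusTensorGrade C L 1 := by
  induction hx using Submodule.span_induction with
  | zero => simp
  | add y y' _ _ h h' => rw [map_add]; exact Submodule.add_mem _ h h'
  | smul r y _ h => rw [map_smul]; exact Submodule.smul_mem _ r h
  | mem y hy =>
    obtain ⟨i, j, hi, hij, a, ha, w, hw, rfl⟩ := hy
    rw [TensorProduct.map_tmul, LinearMap.id_apply]
    by_cases hj : 0 < j
    · rw [hL j hj, Submodule.mem_bot] at hw
      rw [hw, TensorProduct.tmul_zero]
      exact Submodule.zero_mem _
    · exact Submodule.subset_span ⟨i - 1, j, by omega, by omega, s a, hs i a ha, w, hw, rfl⟩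

/-- A contraction of the kernel of `p : C → B` induces a contraction of the kernel of
`C ⊗ L → B ⊗ L`. -/
theorem tensorD_contraction {p : CDGA.Hom C B} (hp : Function.Surjective p.toAlgHom)
    {s : C →ₗ[ℚ] C} (hs : ∀ i, ∀ a ∈ C.grade i, s a ∈ C.grade (i - 1))
    (hsd : ∀ a, p.toAlgHom a = 0 → C.d (s a) + s (C.d a) = a) {x : C ⊗[ℚ] L}
    (hx : tensorHom p (DGLA.Hom.id L) x = 0) :
    tensorD C L (TensorProduct.map s LinearMap.id x) +
      TensorProduct.map s LinearMap.id (tensorD C L x) = x := by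
  have hσ : ∀ a, signMap C.grade (s a) = -s (signMap C.grade a) := by
    intro a
    induction a using DirectSum.Decomposition.inductionOn C.grade with
    | zero => simp
    | @homogeneous i m =>
      rw [signMap_apply_of_mem _ m.2, signMap_apply_of_mem _ (hs _ _ m.2), map_smul,
        zpow_sub₀ (by norm_num), zpow_one, div_neg, div_one, neg_smul]
    | add m m' h h' => simp only [map_add, h, h', neg_add]
  obtain ⟨x, rfl⟩ := (rTensor_exact L (LinearMap.exact_subtype_ker_map p.toAlgHom.toLinearMap)
    hp x).1 hx
  induction x using TensorProduct.induction_on with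
  | zero => simp
  | add x y h h' =>
    have hker : ∀ x, tensorHom p (DGLA.Hom.id L)
        (LinearMap.rTensor L (LinearMap.ker p.toAlgHom.toLinearMap).subtype x) = 0 := fun x =>
      (rTensor_exact L (LinearMap.exact_subtype_ker_map p.toAlgHom.toLinearMap) hp _).2 ⟨x, rfl⟩
    simp only [map_add]
    rw [add_add_add_comm, h (hker _), h' (hker _)]
  | tmul k w =>
    have hk : C.d (s k) + s (C.d k) = k := hsd _ k.2
    simp only [LinearMap.rTensor_tmul, Submodule.subtype_apply, tensorD, LinearMap.add_apply,
      TensorProduct.map_tmul, LinearMap.id_apply, map_add, hσ, TensorProduct.neg_tmul]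
    conv_rhs => rw [← hk, TensorProduct.add_tmul]
    abel

/-- Elements of degree one with prescribed central curvature `ζ` lift along surjective
quasi-isomorphisms. Starting from any lift `α`, the error `R = F(α) - ζ` lies in the kernel of
`C ⊗ L → B ⊗ L`, and, if it lies in the `n`-th step of the lower central series, then the Bianchi
identity shows that it is a cocycle modulo the next one; subtracting from `α` the image of `R` under
a contraction of the kernel moves the error into the next step. -/
theorem exists_lift_of_curvature {p : CDGA.Hom C B} (hq : p.IsQuasiIso)
    (hp : Function.Surjective p.toAlgHom) (hL : L.IsNonpositive) (hnil : L.IsNilpotent)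
    {β : B ⊗[ℚ] L} (hβ : β ∈ plusTensorGrade B L 1) {ζ : C ⊗[ℚ] L}
    (hζ : ζ ∈ plusTensorGrade C L (1 + 1)) (hdζ : tensorD C L ζ = 0)
    (hcentral : ∀ x, tensorBracket C L x ζ = 0)
    (hβζ : curvature B L β = tensorHom p (DGLA.Hom.id L) ζ) :
    ∃ α ∈ plusTensorGrade C L 1, tensorHom p (DGLA.Hom.id L) α = β ∧ curvature C L α = ζ := by
  obtain ⟨s, hs, hps, hsd⟩ := hq.exists_contraction hp
  have approx : ∀ n, ∃ α ∈ plusTensorGrade C L 1, tensorHom p (DGLA.Hom.id L) α = β ∧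
      curvature C L α - ζ ∈ tensorSubspace C (L.lowerCentralSeries n) := by
    intro n
    induction n with
    | zero =>
      obtain ⟨α, hα, h⟩ := exists_tensorHom_eq_of_surjective p hp hβ
      exact ⟨α, hα, h, mem_tensorSubspace_top _⟩
    | succ n ih =>
      obtain ⟨α, hα, hαβ, hR⟩ := ih
      set R := curvature C L α - ζ with hRdef
      set S : C ⊗[ℚ] L →ₗ[ℚ] C ⊗[ℚ] L := TensorProduct.map s LinearMap.id with hS
      have hpS : ∀ x, tensorHom p (DGLA.Hom.id L) (S x) = 0 := by
        intro x
        induction x using TensorProduct.induction_on with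
        | zero => simp
        | add x y hx hy => simp only [map_add, hx, hy, add_zero]
        | tmul a w =>
          rw [hS, TensorProduct.map_tmul, tensorHom_tmul, hps, TensorProduct.zero_tmul]
      have hpR : tensorHom p (DGLA.Hom.id L) R = 0 := by
        rw [hRdef, map_sub, tensorHom_curvature, hαβ, hβζ, sub_self]
      have hDR : tensorD C L R = -tensorBracket C L α R := by
        rw [hRdef, map_sub, map_sub, tensorD_curvature hα, hdζ, hcentral, sub_zero, sub_zero]
      have hSR : S R ∈ plusTensorGrade C L 1 := map_id_mem_plusTensorGrade hs hL
        (Submodule.sub_mem _ (curvature_mem_plusTensorGrade hα) hζ)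
      have hSRn : S R ∈ tensorSubspace C (L.lowerCentralSeries n) :=
        map_id_mem_tensorSubspace s hR
      have hcontr : tensorD C L (S R) + S (tensorD C L R) = R := tensorD_contraction hp hs hsd hpR
      refine ⟨α + -S R, Submodule.add_mem _ hα (Submodule.neg_mem _ hSR), ?_, ?_⟩
      · rw [map_add, map_neg, hpS, hαβ, neg_zero, add_zero]
      · have hcalc : curvature C L (α + -S R) - ζ = S (tensorD C L R) - tensorBracket C L α (S R) +
            (1 / 2 : ℚ) • tensorBracket C L (S R) (S R) := by
          rw [curvature_add (plusTensorGrade_le _ _ _ hα)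
            (plusTensorGrade_le _ _ _ (Submodule.neg_mem _ hSR))]
          simp only [map_neg, LinearMap.neg_apply, neg_neg]
          rw [eq_sub_of_add_eq' hcontr, hRdef]
          abel
        rw [hcalc, hDR, map_neg]
        refine Submodule.add_mem _ (Submodule.sub_mem _ (Submodule.neg_mem _ ?_) ?_)
          (Submodule.smul_mem _ _ ?_)
        · exact map_id_mem_tensorSubspace s (tensorBracket_mem_tensorSubspace _ hR)
        · exact tensorBracket_mem_tensorSubspace _ hSRn
        · exact tensorBracket_mem_tensorSubspace _ hSRn
  obtain ⟨n, hn⟩ := hnil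
  obtain ⟨α, hα, hαβ, hR⟩ := approx n
  rw [hn] at hR
  exact ⟨α, hα, hαβ, sub_eq_zero.1 (eq_zero_of_mem_tensorSubspace_bot hR)⟩

/-- The degree of the coefficient of a nonzero homogeneous vector can be read off from the total
degree. -/
theorem mem_grade_of_tmul_mem_plusTensorGrade {n q : ℤ} {a : C} {w : L} (hw : w ∈ L.grade q)
    (hw0 : w ≠ 0) (h : a ⊗ₜ[ℚ] w ∈ plusTensorGrade C L n) : a ∈ C.grade (n - q) := by
  obtain ⟨φ, hφ, -⟩ := Submodule.exists_le_ker_of_notMem (p := (⊥ : Submodule ℚ L)) (v := w) hw0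
  let Φ : C ⊗[ℚ] L →ₗ[ℚ] C := (TensorProduct.rid ℚ C).toLinearMap ∘ₗ
    TensorProduct.map LinearMap.id (φ ∘ₗ homProj L.grade q)
  have hΦ : ∀ (b : C) (v : L), Φ (b ⊗ₜ[ℚ] v) = φ (homProj L.grade q v) • b := fun b v => rfl
  have hmem : ∀ x ∈ plusTensorGrade C L n, Φ x ∈ C.grade (n - q) := by
    intro x hx
    induction hx using Submodule.span_induction with
    | zero => simp
    | add y y' _ _ h h' => rw [map_add]; exact Submodule.add_mem _ h h'
    | smul r y _ h => rw [map_smul]; exact Submodule.smul_mem _ r h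
    | mem y hy =>
      obtain ⟨i, j, -, rfl, b, hb, v, hv, rfl⟩ := hy
      rw [hΦ]
      by_cases hjq : j = q
      · subst hjq
        rw [add_sub_cancel_right]
        exact Submodule.smul_mem _ _ hb
      · rw [homProj_of_mem_ne _ hv hjq, map_zero, zero_smul]
        exact Submodule.zero_mem _
  have := hmem _ h
  rw [hΦ, homProj_of_mem _ hw] at this
  exact (Submodule.smul_mem_iff _ hφ).1 this

end Lifting

namespace MCProductData

variable {D : MCProductData.{v}} {C B : CDGA.{u}}

theorem ProductsDecompose.of_surjective_quasiIso {p : CDGA.Hom C B} (hq : p.IsQuasiIso)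
    (hp : Function.Surjective p.toAlgHom) (hC : D.ProductsDecompose C) :
    D.ProductsDecompose B := by
  intro x hx
  obtain ⟨y, rfl⟩ := hq.2 x
  obtain ⟨β, hβ, c, hc, hcy⟩ := D.mem_MP_iff.1 hx
  have hcmem : (c : B) ∈ B.grade (1 + 1 - D.q) := by
    refine mem_grade_of_tmul_mem_plusTensorGrade D.gen_mem D.gen_ne_zero ?_
    rw [← hc]
    exact curvature_mem_plusTensorGrade hβ
  obtain ⟨z, hz, hzc, rfl⟩ := hq.exists_cocycle_lift hp y hcy hcmem
  have hζ : (z : C) ⊗ₜ[ℚ] D.gen ∈ plusTensorGrade C D.Ltot (1 + 1) := by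
    have := tmul_mem_plusTensorGrade (by have := D.q_nonpos; omega) hz D.gen_mem
    rwa [sub_add_cancel] at this
  have hdζ : tensorD C D.Ltot ((z : C) ⊗ₜ[ℚ] D.gen) = 0 := by
    have hdz : C.d z = 0 := z.2
    rw [tensorD_tmul C D.Ltot hz, D.d_gen, hdz]
    simp
  have hcentral : ∀ t, tensorBracket C D.Ltot t ((z : C) ⊗ₜ[ℚ] D.gen) = 0 := by
    intro t
    induction t using tensor_homogeneous_induction with
    | zero => simp
    | add x y hx hy => simp only [map_add, LinearMap.add_apply, hx, hy, add_zero]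
    | tmul i j a w ha hw =>
      rw [tensorBracket_tmul C D.Ltot a hw hz, D.bracket_gen_right, TensorProduct.tmul_zero,
        smul_zero]
  have hβζ : curvature B D.Ltot β = tensorHom p (DGLA.Hom.id _) ((z : C) ⊗ₜ[ℚ] D.gen) := by
    rw [hc, tensorHom_tmul, hzc]
    rfl
  obtain ⟨α, hα, -, hαz⟩ := exists_lift_of_curvature hq hp D.Ltot_nonpositive D.Ltot_nilpotent hβ
    hζ hdζ hcentral hβζ
  exact p.mapCohomology_mem_decomposables (hC _ (D.mem_MP_iff.2 ⟨α, hα, z, hαz, rfl⟩))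

end MCProductData

namespace CDGA

/-! ### Polynomials with coefficients in a commutative DGA -/

section Poly

variable (B : CDGA.{u})

/-- The part of degree `i` of `B[t] = B ⊗ ℚ[t]`, where `t` has degree `0`. -/
noncomputable def polyGrade (i : ℤ) : Submodule ℚ (B ⊗[ℚ] Polynomial ℚ) :=
  Submodule.span ℚ {x | ∃ b ∈ B.grade i, ∃ q : Polynomial ℚ, b ⊗ₜ[ℚ] q = x}

variable {B}

theorem tmul_mem_polyGrade {i : ℤ} {b : B} (hb : b ∈ B.grade i) (q : Polynomial ℚ) :
    b ⊗ₜ[ℚ] q ∈ B.polyGrade i := Submodule.subset_span ⟨b, hb, q, rfl⟩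

variable (B) in
theorem polyGrade_isInternal : DirectSum.IsInternal B.polyGrade := by
  refine isInternal_of_projections _
    (fun i => TensorProduct.map (homProj B.grade i) LinearMap.id) ?_ ?_ ?_
  · intro i x hx
    induction hx using Submodule.span_induction with
    | zero => simp
    | add x y _ _ hx hy => rw [map_add, hx, hy]
    | smul r x _ hx => rw [map_smul, hx]
    | mem x hx =>
      obtain ⟨b, hb, q, rfl⟩ := hx
      rw [TensorProduct.map_tmul, homProj_of_mem _ hb, LinearMap.id_apply]
  · intro i j hij x hx
    induction hx using Submodule.span_induction with
    | zero => simp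
    | add x y _ _ hx hy => rw [map_add, hx, hy, add_zero]
    | smul r x _ hx => rw [map_smul, hx, smul_zero]
    | mem x hx =>
      obtain ⟨b, hb, q, rfl⟩ := hx
      rw [TensorProduct.map_tmul, homProj_of_mem_ne _ hb hij, TensorProduct.zero_tmul]
  · intro x
    induction x using TensorProduct.induction_on with
    | zero => exact Submodule.zero_mem _
    | add x y hx hy => exact Submodule.add_mem _ hx hy
    | tmul b q =>
      induction b using DirectSum.Decomposition.inductionOn B.grade with
      | zero => simp
      | @homogeneous i m => exact Submodule.mem_iSup_of_mem i (tmul_mem_polyGrade m.2 q)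
      | add m m' h h' => rw [TensorProduct.add_tmul]; exact Submodule.add_mem _ h h'

noncomputable instance polyGradedAlgebra : GradedAlgebra B.polyGrade where
  one_mem := tmul_mem_polyGrade SetLike.GradedOne.one_mem 1
  mul_mem := by
    intro i j x y hx hy
    induction hx using Submodule.span_induction with
    | zero => simp
    | add x x' _ _ h h' => rw [add_mul]; exact Submodule.add_mem _ h h'
    | smul r x _ h => rw [smul_mul_assoc]; exact Submodule.smul_mem _ r h
    | mem x hx =>
      obtain ⟨b, hb, q, rfl⟩ := hx
      induction hy using Submodule.span_induction with
      | zero => simp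
      | add x x' _ _ h h' => rw [mul_add]; exact Submodule.add_mem _ h h'
      | smul r x _ h => rw [mul_smul_comm]; exact Submodule.smul_mem _ r h
      | mem y hy =>
        obtain ⟨b', hb', q', rfl⟩ := hy
        rw [Algebra.TensorProduct.tmul_mul_tmul]
        exact tmul_mem_polyGrade (SetLike.GradedMul.mul_mem hb hb') _
  toDecomposition := B.polyGrade_isInternal.chooseDecomposition

variable (B) in
/-- The commutative DGA `B[t] = B ⊗ ℚ[t]`, where `t` has degree `0` and `d t = 0`. -/
noncomputable def poly : CDGA.{u} where
  carrier := B ⊗[ℚ] Polynomial ℚ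
  grade := B.polyGrade
  mul_comm' := by
    intro i j x y hx hy
    induction hx using Submodule.span_induction with
    | zero => simp
    | add x x' _ _ h h' => rw [add_mul, mul_add, smul_add, h, h']
    | smul r x _ h => rw [smul_mul_assoc, mul_smul_comm, h, smul_comm]
    | mem x hx =>
      obtain ⟨b, hb, q, rfl⟩ := hx
      induction hy using Submodule.span_induction with
      | zero => simp
      | add x x' _ _ h h' => rw [add_mul, mul_add, smul_add, h, h']
      | smul r x _ h => rw [smul_mul_assoc, mul_smul_comm, h, smul_comm]
      | mem y hy =>
        obtain ⟨b', hb', q', rfl⟩ := hy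
        rw [Algebra.TensorProduct.tmul_mul_tmul, Algebra.TensorProduct.tmul_mul_tmul,
          B.mul_comm' hb hb', mul_comm q, TensorProduct.smul_tmul']
  d := TensorProduct.map B.d LinearMap.id
  d_mem := by
    intro i x hx
    induction hx using Submodule.span_induction with
    | zero => simp
    | add x x' _ _ h h' => rw [map_add]; exact Submodule.add_mem _ h h'
    | smul r x _ h => rw [map_smul]; exact Submodule.smul_mem _ r h
    | mem x hx =>
      obtain ⟨b, hb, q, rfl⟩ := hx
      exact tmul_mem_polyGrade (B.d_mem hb) q
  d_d := by
    intro x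
    induction x using TensorProduct.induction_on with
    | zero => simp
    | add x y hx hy => rw [map_add, map_add, hx, hy, add_zero]
    | tmul b q => simp [B.d_d]
  leibniz := by
    intro i x hx y
    induction hx using Submodule.span_induction with
    | zero => simp
    | add x x' _ _ h h' => simp only [add_mul, map_add, h, h', smul_add]; abel
    | smul r x _ h =>
      rw [smul_mul_assoc, map_smul, map_smul, smul_mul_assoc, smul_mul_assoc, h, smul_add,
        smul_comm r]
    | mem x hx =>
      obtain ⟨b, hb, q, rfl⟩ := hx
      induction y using TensorProduct.induction_on with
      | zero => simp
      | add x x' h h' => simp only [mul_add, map_add, h, h', smul_add]; abel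
      | tmul b' q' =>
        simp only [Algebra.TensorProduct.tmul_mul_tmul, TensorProduct.map_tmul, B.leibniz hb,
          LinearMap.id_apply, TensorProduct.add_tmul, TensorProduct.smul_tmul']

/-- The pure tensor `b ⊗ q`, as an element of `B[t]`. It keeps the type `B.poly` apart from the tensor
product that underlies it, whose ring structure agrees with that of `B.poly` only after unfolding. -/
noncomputable def polyTmul (b : B) (q : Polynomial ℚ) : B.poly := b ⊗ₜ[ℚ] q

theorem polyTmul_mul_polyTmul (b b' : B) (q q' : Polynomial ℚ) :
    polyTmul b q * polyTmul b' q' = polyTmul (b * b') (q * q') :=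
  Algebra.TensorProduct.tmul_mul_tmul b b' q q'

theorem polyTmul_add (b : B) (q q' : Polynomial ℚ) :
    polyTmul b (q + q') = polyTmul b q + polyTmul b q' := TensorProduct.tmul_add b q q'

theorem smul_polyTmul (r : ℚ) (b : B) (q : Polynomial ℚ) :
    polyTmul (r • b) q = polyTmul b (r • q) := TensorProduct.smul_tmul r b q

@[elab_as_elim]
theorem poly_induction {motive : B.poly → Prop} (zero : motive 0)
    (add : ∀ x y, motive x → motive y → motive (x + y))
    (tmul : ∀ (b : B) (q : Polynomial ℚ), motive (polyTmul b q)) (x : B.poly) : motive x :=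
  TensorProduct.induction_on (motive := motive) x zero tmul add

@[elab_as_elim]
theorem poly_grade_induction {i : ℤ} {motive : B.poly → Prop} (zero : motive 0)
    (add : ∀ x y, motive x → motive y → motive (x + y))
    (smul : ∀ (r : ℚ) x, motive x → motive (r • x))
    (tmul : ∀ b ∈ B.grade i, ∀ q : Polynomial ℚ, motive (polyTmul b q))
    {x : B.poly} (hx : x ∈ B.poly.grade i) : motive x :=
  Submodule.span_induction (p := fun x _ => motive x)
    (by rintro _ ⟨b, hb, q, rfl⟩; exact tmul b hb q) zero (fun x y _ _ => add x y)
    (fun r x _ => smul r x) hx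

theorem polyTmul_mem {i : ℤ} {b : B} (hb : b ∈ B.grade i) (q : Polynomial ℚ) :
    polyTmul b q ∈ B.poly.grade i := tmul_mem_polyGrade hb q

variable (B) in
/-- The morphism `B[t] → B` of evaluation at `t = r`. -/
noncomputable def polyEval (r : ℚ) : Hom B.poly B where
  toAlgHom := (Algebra.TensorProduct.rid ℚ ℚ B).toAlgHom.comp
    (Algebra.TensorProduct.map (AlgHom.id ℚ B) (Polynomial.aeval r))
  map_mem := by
    intro i x hx
    refine poly_grade_induction ?_ (fun x x' h h' => ?_) (fun r x h => ?_) (fun b hb q => ?_) hx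
    · rw [map_zero]; exact Submodule.zero_mem _
    · rw [map_add]; exact Submodule.add_mem _ h h'
    · rw [map_smul]; exact Submodule.smul_mem _ r h
    · exact Submodule.smul_mem _ _ hb
  map_d := by
    intro x
    induction x using poly_induction with
    | zero => rw [map_zero, map_zero, map_zero]
    | add x y hx hy => rw [map_add, map_add, map_add, map_add, hx, hy]
    | tmul b q => exact (map_smul B.d _ _).symm

theorem polyEval_polyTmul (r : ℚ) (b : B) (q : Polynomial ℚ) :
    (B.polyEval r).toAlgHom (polyTmul b q) = q.eval r • b := by
  rw [← Polynomial.coe_aeval_eq_eval]; rfl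

variable (B) in
/-- The inclusion `B → B[t]` of the constant polynomials. -/
noncomputable def polyConst : Hom B B.poly where
  toAlgHom := Algebra.TensorProduct.includeLeft
  map_mem hb := tmul_mem_polyGrade hb 1
  map_d _ := rfl

theorem polyConst_apply (b : B) : B.polyConst.toAlgHom b = polyTmul b 1 := rfl

theorem polyEval_polyConst (r : ℚ) (b : B) :
    (B.polyEval r).toAlgHom (B.polyConst.toAlgHom b) = b := by
  rw [polyConst_apply, polyEval_polyTmul, Polynomial.eval_one, one_smul]

/-- The endomorphism of `B[t]` given by an endomorphism of `ℚ[t]`. -/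
noncomputable def polyMap (φ : Polynomial ℚ →ₗ[ℚ] Polynomial ℚ) : B.poly →ₗ[ℚ] B.poly :=
  TensorProduct.map (LinearMap.id : B →ₗ[ℚ] B) φ

theorem polyMap_polyTmul (φ : Polynomial ℚ →ₗ[ℚ] Polynomial ℚ) (b : B) (q : Polynomial ℚ) :
    polyMap φ (polyTmul b q) = polyTmul b (φ q) := rfl

theorem polyMap_mem (φ : Polynomial ℚ →ₗ[ℚ] Polynomial ℚ) {i : ℤ} {x : B.poly}
    (hx : x ∈ B.poly.grade i) : polyMap φ x ∈ B.poly.grade i := by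
  refine poly_grade_induction ?_ (fun x x' h h' => ?_) (fun r x h => ?_) (fun b hb q => ?_) hx
  · rw [map_zero]; exact Submodule.zero_mem _
  · rw [map_add]; exact Submodule.add_mem _ h h'
  · rw [map_smul]; exact Submodule.smul_mem _ r h
  · exact polyTmul_mem hb _

theorem polyMap_d (φ : Polynomial ℚ →ₗ[ℚ] Polynomial ℚ) (x : B.poly) :
    polyMap φ (B.poly.d x) = B.poly.d (polyMap φ x) := by
  induction x using poly_induction with
  | zero => simp only [map_zero]
  | add x x' h h' => simp only [map_add, h, h']
  | tmul b q => rfl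

variable (B) in
/-- The derivative `∂/∂t` on `B[t]`. -/
noncomputable def polyDeriv : B.poly →ₗ[ℚ] B.poly := polyMap Polynomial.derivative

/-- The integral `∫₀ᵗ` on `ℚ[t]`. -/
noncomputable def integral : Polynomial ℚ →ₗ[ℚ] Polynomial ℚ :=
  Polynomial.lsum fun n => ((n + 1 : ℚ)⁻¹) • Polynomial.monomial (n + 1)

theorem integral_monomial (n : ℕ) (r : ℚ) :
    integral (Polynomial.monomial n r) = ((n + 1 : ℚ)⁻¹) • Polynomial.monomial (n + 1) r := by
  simp [integral, Polynomial.lsum_apply]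

theorem derivative_integral (q : Polynomial ℚ) : Polynomial.derivative (integral q) = q := by
  induction q using Polynomial.induction_on' with
  | add p q hp hq => rw [map_add, map_add, hp, hq]
  | monomial n r =>
    have : (n + 1 : ℚ) ≠ 0 := by positivity
    rw [integral_monomial, map_smul, Polynomial.derivative_monomial, Polynomial.smul_monomial]
    simp only [Nat.add_sub_cancel, smul_eq_mul]
    push_cast
    congr 1
    field_simp

theorem integral_derivative (q : Polynomial ℚ) :
    integral (Polynomial.derivative q) = q - Polynomial.C (q.eval 0) := by
  induction q using Polynomial.induction_on' with
  | add p q hp hq => rw [map_add, map_add, hp, hq, Polynomial.eval_add, map_add]; abel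
  | monomial n r =>
    rw [Polynomial.derivative_monomial, integral_monomial]
    cases n with
    | zero => simp
    | succ n =>
      have : (n + 1 : ℚ) ≠ 0 := by positivity
      rw [Polynomial.smul_monomial]
      simp only [Nat.add_sub_cancel, Polynomial.eval_monomial, smul_eq_mul]
      simp
      congr 1
      field_simp

theorem eval_zero_integral (q : Polynomial ℚ) : (integral q).eval 0 = 0 := by
  induction q using Polynomial.induction_on' with
  | add p q hp hq => rw [map_add, Polynomial.eval_add, hp, hq, add_zero]
  | monomial n r => simp [integral_monomial]

variable (B) in
/-- The integral `∫₀ᵗ` on `B[t]`. -/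
noncomputable def polyIntegral : B.poly →ₗ[ℚ] B.poly := polyMap integral

theorem polyDeriv_mul (x y : B.poly) :
    B.polyDeriv (x * y) = B.polyDeriv x * y + x * B.polyDeriv y := by
  induction x using poly_induction with
  | zero => simp only [zero_mul, map_zero, add_zero]
  | add x x' h h' => simp only [add_mul, map_add, h, h']; abel
  | tmul b q =>
    induction y using poly_induction with
    | zero => simp only [mul_zero, map_zero, add_zero]
    | add x x' h h' => simp only [mul_add, map_add, h, h']; abel
    | tmul b' q' =>
      simp only [polyDeriv, polyMap_polyTmul, polyTmul_mul_polyTmul, Polynomial.derivative_mul,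
        polyTmul_add]

theorem polyDeriv_polyConst (b : B) : B.polyDeriv (B.polyConst.toAlgHom b) = 0 := by
  rw [polyConst_apply, polyDeriv, polyMap_polyTmul, Polynomial.derivative_one]
  exact TensorProduct.tmul_zero _ b

theorem polyDeriv_polyIntegral (x : B.poly) : B.polyDeriv (B.polyIntegral x) = x := by
  induction x using poly_induction with
  | zero => simp only [map_zero]
  | add x x' h h' => simp only [map_add, h, h']
  | tmul b q => rw [polyDeriv, polyIntegral, polyMap_polyTmul, polyMap_polyTmul, derivative_integral]

theorem polyIntegral_polyDeriv (x : B.poly) :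
    B.polyIntegral (B.polyDeriv x) = x - B.polyConst.toAlgHom ((B.polyEval 0).toAlgHom x) := by
  induction x using poly_induction with
  | zero => simp only [map_zero, sub_zero]
  | add x x' h h' => simp only [map_add, h, h']; abel
  | tmul b q =>
    rw [polyEval_polyTmul, polyConst_apply, smul_polyTmul, Polynomial.smul_eq_C_mul, mul_one,
      eq_sub_iff_add_eq, polyDeriv, polyIntegral, polyMap_polyTmul, polyMap_polyTmul,
      ← polyTmul_add, integral_derivative, sub_add_cancel]

theorem polyEval_zero_polyIntegral (x : B.poly) :
    (B.polyEval 0).toAlgHom (B.polyIntegral x) = 0 := by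
  induction x using poly_induction with
  | zero => simp only [map_zero]
  | add x x' h h' => simp only [map_add, h, h', add_zero]
  | tmul b q =>
    rw [polyIntegral, polyMap_polyTmul, polyEval_polyTmul, eval_zero_integral, zero_smul]

end Poly

end CDGA

/-! ### Adjoining the differential of a parameter -/

/-- The underlying space of `T ⊕ T dt`, for a commutative DGA `T`; the pair `(u, v)` stands for
`u + v dt`, where `dt` has degree `1`. -/
def AdjoinDt (T : CDGA.{u}) : Type u := T × T

namespace AdjoinDt

variable {T : CDGA.{u}}

instance : AddCommGroup (AdjoinDt T) := inferInstanceAs (AddCommGroup (T × T))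
instance : Module ℚ (AdjoinDt T) := inferInstanceAs (Module ℚ (T × T))

/-- The coefficient `u` of `u + v dt`. -/
def fn : AdjoinDt T →ₗ[ℚ] T := LinearMap.fst ℚ T T

/-- The coefficient `v` of `u + v dt`. -/
def form : AdjoinDt T →ₗ[ℚ] T := LinearMap.snd ℚ T T

/-- The element `u + v dt`. -/
def mk (u v : T) : AdjoinDt T := (u, v)

@[simp] theorem fn_mk (u v : T) : fn (mk u v) = u := rfl
@[simp] theorem form_mk (u v : T) : form (mk u v) = v := rfl

theorem ext {x y : AdjoinDt T} (h : fn x = fn y) (h' : form x = form y) : x = y := Prod.ext h h'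

/-- The product of `T ⊕ T dt`, determined by `dt x = (-1) ^ |x| x dt` and `dt dt = 0`. -/
noncomputable instance : Mul (AdjoinDt T) :=
  ⟨fun x y => mk (fn x * fn y) (fn x * form y + form x * signMap T.grade (fn y))⟩

instance : One (AdjoinDt T) := ⟨mk 1 0⟩

@[simp] theorem fn_mul (x y : AdjoinDt T) : fn (x * y) = fn x * fn y := rfl
@[simp] theorem form_mul (x y : AdjoinDt T) :
    form (x * y) = fn x * form y + form x * signMap T.grade (fn y) := rfl
@[simp] theorem fn_one : fn (1 : AdjoinDt T) = 1 := rfl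
@[simp] theorem form_one : form (1 : AdjoinDt T) = 0 := rfl

noncomputable instance : Ring (AdjoinDt T) where
  __ := (inferInstance : AddCommGroup (AdjoinDt T))
  left_distrib x y z := ext (by simp [mul_add]) (by simp [mul_add]; abel)
  right_distrib x y z := ext (by simp [add_mul]) (by simp [add_mul]; abel)
  zero_mul x := ext (by simp) (by simp)
  mul_zero x := ext (by simp) (by simp)
  mul_assoc x y z := ext (by simp [mul_assoc])
    (by simp [mul_add, add_mul, mul_assoc, T.signMap_mul]; abel)
  one_mul x := ext (by simp) (by simp)
  mul_one x := ext (by simp) (by simp [T.signMap_one])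

noncomputable instance : Algebra ℚ (AdjoinDt T) :=
  Algebra.ofModule
    (fun r x y => ext (by simp) (by simp))
    (fun r x y => ext (by simp) (by simp))

variable (T) in
/-- The part of degree `i` of `T ⊕ T dt`. -/
noncomputable def grade (i : ℤ) : Submodule ℚ (AdjoinDt T) :=
  (T.grade i).comap fn ⊓ (T.grade (i - 1)).comap form

theorem mem_grade {i : ℤ} {x : AdjoinDt T} :
    x ∈ grade T i ↔ fn x ∈ T.grade i ∧ form x ∈ T.grade (i - 1) := Iff.rfl

variable (T) in
theorem grade_isInternal : DirectSum.IsInternal (grade T) := by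
  refine isInternal_of_projections _ (fun i => LinearMap.prodMap (homProj T.grade i)
    (homProj T.grade (i - 1))) ?_ ?_ ?_
  · intro i x hx
    exact ext (homProj_of_mem _ hx.1) (homProj_of_mem _ hx.2)
  · intro i j hij x hx
    exact ext (homProj_of_mem_ne _ hx.1 hij) (homProj_of_mem_ne _ hx.2 (by omega))
  · intro x
    have h1 : ∀ u : T, mk u 0 ∈ ⨆ i, grade T i := by
      intro u
      induction u using DirectSum.Decomposition.inductionOn T.grade with
      | zero => exact Submodule.zero_mem _
      | @homogeneous i m =>
        exact Submodule.mem_iSup_of_mem i (mem_grade.2 ⟨m.2, Submodule.zero_mem _⟩)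
      | add m m' h h' =>
        have := Submodule.add_mem _ h h'
        rwa [show mk m 0 + mk m' 0 = mk (m + m') (0 : T) from ext (by simp) (by simp)] at this
    have h2 : ∀ v : T, mk 0 v ∈ ⨆ i, grade T i := by
      intro v
      induction v using DirectSum.Decomposition.inductionOn T.grade with
      | zero => exact Submodule.zero_mem _
      | @homogeneous i m =>
        refine Submodule.mem_iSup_of_mem (i + 1) (mem_grade.2 ⟨Submodule.zero_mem _, ?_⟩)
        rw [add_sub_cancel_right]
        exact m.2
      | add m m' h h' =>
        have := Submodule.add_mem _ h h'
        rwa [show mk 0 m + mk 0 m' = mk (0 : T) (m + m') from ext (by simp) (by simp)] at this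
    have := Submodule.add_mem _ (h1 (fn x)) (h2 (form x))
    rwa [show mk (fn x) 0 + mk 0 (form x) = x from ext (by simp) (by simp)] at this

noncomputable instance : GradedAlgebra (grade T) where
  one_mem := mem_grade.2 ⟨SetLike.GradedOne.one_mem, Submodule.zero_mem _⟩
  mul_mem := by
    intro i j x y hx hy
    rw [mem_grade] at *
    refine ⟨SetLike.GradedMul.mul_mem hx.1 hy.1, Submodule.add_mem _ ?_ ?_⟩
    · rw [add_sub_assoc]
      exact SetLike.GradedMul.mul_mem hx.1 hy.2
    · rw [add_sub_right_comm, signMap_apply_of_mem _ hy.1, mul_smul_comm]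
      exact Submodule.smul_mem _ _ (SetLike.GradedMul.mul_mem hx.2 hy.1)
  toDecomposition := (grade_isInternal T).chooseDecomposition

end AdjoinDt

namespace CDGA

open AdjoinDt

variable {T : CDGA.{u}}

theorem neg_one_zpow_sub_one (i : ℤ) : (-1 : ℚ) ^ (i - 1) = -(-1 : ℚ) ^ i := by
  rw [zpow_sub₀ (by norm_num), zpow_one, div_neg, div_one]

/-- A derivation `δ` of degree `0` of `T`, thought of as the derivative with respect to a parameter
`t`, makes `T ⊕ T dt` a commutative DGA, with differential
`d (u + v dt) = d_T u + (-1) ^ |u| (δ u) dt + (d_T v) dt`. -/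
noncomputable def adjoinDt (δ : T →ₗ[ℚ] T)
    (hδ : ∀ {i : ℤ} {x : T}, x ∈ T.grade i → δ x ∈ T.grade i)
    (hmul : ∀ x y, δ (x * y) = δ x * y + x * δ y) (hd : ∀ x, δ (T.d x) = T.d (δ x)) : CDGA.{u} where
  carrier := AdjoinDt T
  grade := AdjoinDt.grade T
  mul_comm' := by
    intro i j x y hx hy
    rw [mem_grade] at hx hy
    refine AdjoinDt.ext ?_ ?_
    · rw [fn_mul, T.mul_comm' hx.1 hy.1, map_smul, fn_mul]
    · rw [form_mul, map_smul, form_mul, signMap_apply_of_mem _ hx.1, signMap_apply_of_mem _ hy.1,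
        T.mul_comm' hx.1 hy.2, mul_smul_comm, mul_smul_comm, T.mul_comm' hx.2 hy.1, smul_add,
        smul_smul, smul_smul, ← zpow_add₀ (by norm_num), ← zpow_add₀ (by norm_num), add_comm]
      congr 2 <;> apply neg_one_zpow_congr <;>
        simp only [Int.even_add, Int.even_sub, Int.even_mul, Int.not_even_one] <;> tauto
  d := LinearMap.prod (T.d ∘ₗ fn) (signMap T.grade ∘ₗ δ ∘ₗ fn + T.d ∘ₗ form)
  d_mem := by
    intro i x hx
    rw [mem_grade] at hx
    refine ⟨T.d_mem hx.1, Submodule.add_mem _ ?_ ?_⟩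
    · change signMap T.grade (δ (fn x)) ∈ _
      rw [signMap_apply_of_mem _ (hδ hx.1), add_sub_cancel_right]
      exact Submodule.smul_mem _ _ (hδ hx.1)
    · have := T.d_mem hx.2
      rwa [sub_add_eq_add_sub] at this
  d_d := by
    intro x
    refine AdjoinDt.ext (T.d_d _) ?_
    change signMap T.grade (δ (T.d (fn x))) + T.d (signMap T.grade (δ (fn x)) + T.d (form x)) = 0
    rw [map_add, T.d_d, T.d_signMap, hd, add_zero, add_neg_cancel]
  leibniz := by
    intro i x hx y
    rw [mem_grade] at hx
    refine AdjoinDt.ext ?_ ?_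
    · rw [map_add, map_smul]
      exact T.leibniz hx.1 (fn y)
    · rw [map_add, map_smul]
      change signMap T.grade (δ (fn x * fn y)) +
          T.d (fn x * form y + form x * signMap T.grade (fn y)) =
        (T.d (fn x) * form y + (signMap T.grade (δ (fn x)) + T.d (form x)) *
          signMap T.grade (fn y)) +
        (-1 : ℚ) ^ i • (fn x * (signMap T.grade (δ (fn y)) + T.d (form y)) +
          form x * signMap T.grade (T.d (fn y)))
      rw [hmul, map_add, map_add, T.signMap_mul, T.signMap_mul, T.leibniz hx.1, T.leibniz hx.2,
        T.d_signMap, signMap_apply_of_mem _ hx.1, neg_one_zpow_sub_one]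
      simp only [mul_add, add_mul, smul_add, mul_neg, smul_neg, neg_smul, neg_neg, smul_mul_assoc]
      abel

/-! ### Fibre products -/

section Pullback

variable {A P B : CDGA.{u}} (f : Hom A B) (e : Hom P B)

/-- The underlying algebra of the fibre product `A ×_B P`. -/
def pullbackSubalgebra : Subalgebra ℚ (A × P) :=
  AlgHom.equalizer (f.toAlgHom.comp (AlgHom.fst ℚ A P)) (e.toAlgHom.comp (AlgHom.snd ℚ A P))

/-- The part of degree `i` of the fibre product `A ×_B P`. -/
def pullbackGrade (i : ℤ) : Submodule ℚ (pullbackSubalgebra f e) :=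
  ((A.grade i).prod (P.grade i)).comap (pullbackSubalgebra f e).val.toLinearMap

/-- The projection of the fibre product `A ×_B P` onto its part of degree `i`. -/
noncomputable def pullbackProj (i : ℤ) : pullbackSubalgebra f e →ₗ[ℚ] pullbackSubalgebra f e :=
  (LinearMap.prodMap (homProj A.grade i) (homProj P.grade i)).restrict
    (p := Subalgebra.toSubmodule (pullbackSubalgebra f e))
    (q := Subalgebra.toSubmodule (pullbackSubalgebra f e)) fun x hx => by
      have hx' : f.toAlgHom x.1 = e.toAlgHom x.2 := hx
      change f.toAlgHom (homProj A.grade i x.1) = e.toAlgHom (homProj P.grade i x.2)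
      rw [f.map_homProj, e.map_homProj, hx']

theorem pullbackGrade_isInternal : DirectSum.IsInternal (pullbackGrade f e) := by
  classical
  refine isInternal_of_projections _ (pullbackProj f e) ?_ ?_ ?_
  · intro i x hx
    exact Subtype.ext (Prod.ext (homProj_of_mem _ hx.1) (homProj_of_mem _ hx.2))
  · intro i j hij x hx
    exact Subtype.ext (Prod.ext (homProj_of_mem_ne _ hx.1 hij) (homProj_of_mem_ne _ hx.2 hij))
  · intro x
    let s := (DirectSum.decompose A.grade x.1.1).support ∪
      (DirectSum.decompose P.grade x.1.2).support
    have hx : ∑ i ∈ s, pullbackProj f e i x = x := by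
      apply Subtype.ext
      rw [AddSubmonoidClass.coe_finsetSum]
      refine Prod.ext ?_ ?_
      · rw [Prod.fst_sum]
        exact sum_homProj_of_support_subset A.grade Finset.subset_union_left
      · rw [Prod.snd_sum]
        exact sum_homProj_of_support_subset P.grade Finset.subset_union_right
    rw [← hx]
    exact Submodule.sum_mem _ fun i _ => Submodule.mem_iSup_of_mem i
      ⟨homProj_mem _ _ _, homProj_mem _ _ _⟩

noncomputable instance : GradedAlgebra (pullbackGrade f e) where
  one_mem := ⟨SetLike.GradedOne.one_mem (A := A.grade), SetLike.GradedOne.one_mem (A := P.grade)⟩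
  mul_mem _ _ _ _ hx hy := ⟨SetLike.GradedMul.mul_mem (A := A.grade) hx.1 hy.1,
    SetLike.GradedMul.mul_mem (A := P.grade) hx.2 hy.2⟩
  toDecomposition := (pullbackGrade_isInternal f e).chooseDecomposition

/-- The fibre product `A ×_B P` of commutative DGAs. -/
noncomputable def pullback : CDGA.{u} where
  carrier := pullbackSubalgebra f e
  grade := pullbackGrade f e
  mul_comm' hx hy := Subtype.ext (Prod.ext (A.mul_comm' hx.1 hy.1) (P.mul_comm' hx.2 hy.2))
  d := (LinearMap.prodMap A.d P.d).restrict
    (p := Subalgebra.toSubmodule (pullbackSubalgebra f e))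
    (q := Subalgebra.toSubmodule (pullbackSubalgebra f e)) fun x hx => by
      have hx' : f.toAlgHom x.1 = e.toAlgHom x.2 := hx
      change f.toAlgHom (A.d x.1) = e.toAlgHom (P.d x.2)
      rw [f.map_d, e.map_d, hx']
  d_mem hx := ⟨A.d_mem hx.1, P.d_mem hx.2⟩
  d_d x := Subtype.ext (Prod.ext (A.d_d _) (P.d_d _))
  leibniz hx y := Subtype.ext (Prod.ext (A.leibniz hx.1 _) (P.leibniz hx.2 _))

/-- The first projection of a fibre product. -/
noncomputable def pullbackFst : Hom (pullback f e) A where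
  toAlgHom := (AlgHom.fst ℚ A P).comp (pullbackSubalgebra f e).val
  map_mem hx := hx.1
  map_d _ := rfl

/-- The second projection of a fibre product. -/
noncomputable def pullbackSnd : Hom (pullback f e) P where
  toAlgHom := (AlgHom.snd ℚ A P).comp (pullbackSubalgebra f e).val
  map_mem hx := hx.2
  map_d _ := rfl

/-- An element of a fibre product. -/
def pullbackMk (a : A) (x : P) (h : f.toAlgHom a = e.toAlgHom x) : pullback f e := ⟨(a, x), h⟩

variable {f e}

theorem pullback_ext {x y : pullback f e}
    (h : (pullbackFst f e).toAlgHom x = (pullbackFst f e).toAlgHom y)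
    (h' : (pullbackSnd f e).toAlgHom x = (pullbackSnd f e).toAlgHom y) : x = y :=
  Subtype.ext (Prod.ext h h')

variable (f e) in
/-- The morphism `A → A ×_B P` given by the identity of `A` and a morphism `A → P` over `B`. -/
noncomputable def pullbackSection (g : Hom A P)
    (hg : ∀ a, f.toAlgHom a = e.toAlgHom (g.toAlgHom a)) : Hom A (pullback f e) where
  toAlgHom := ((AlgHom.id ℚ A).prod g.toAlgHom).codRestrict (pullbackSubalgebra f e) hg
  map_mem ha := ⟨ha, g.map_mem ha⟩
  map_d a := Subtype.ext (Prod.ext rfl (g.map_d a))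

end Pullback

/-! ### The path object -/

section Path

variable (B : CDGA.{u})

/-- The commutative DGA `B[t, dt]` of polynomial differential forms on the line with coefficients
in `B`. -/
noncomputable def path : CDGA.{u} :=
  adjoinDt B.polyDeriv (polyMap_mem _) polyDeriv_mul (polyMap_d _)

/-- Evaluation at `t = r`, which maps `dt` to `0`. -/
noncomputable def pathEval (r : ℚ) : Hom B.path B where
  toAlgHom := (B.polyEval r).toAlgHom.comp
    (AlgHom.ofLinearMap (AdjoinDt.fn : AdjoinDt B.poly →ₗ[ℚ] B.poly) rfl fun _ _ => rfl)
  map_mem hx := (B.polyEval r).map_mem hx.1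
  map_d x := (B.polyEval r).map_d (AdjoinDt.fn x)

/-- The constant forms. -/
noncomputable def pathConst : Hom B B.path where
  toAlgHom := AlgHom.ofLinearMap
    (LinearMap.prod B.polyConst.toAlgHom.toLinearMap 0 : B →ₗ[ℚ] AdjoinDt B.poly)
    (AdjoinDt.ext (map_one B.polyConst.toAlgHom) rfl)
    (fun x y => AdjoinDt.ext (map_mul B.polyConst.toAlgHom x y) (by
      change (0 : B.poly) = _ * 0 + 0 * _
      rw [mul_zero, zero_mul, add_zero]))
  map_mem hb := ⟨B.polyConst.map_mem hb, Submodule.zero_mem (B.poly.grade _)⟩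
  map_d b := AdjoinDt.ext (B.polyConst.map_d b) (by
    change (0 : B.poly) = signMap _ (B.polyDeriv (B.polyConst.toAlgHom b)) + B.poly.d 0
    rw [polyDeriv_polyConst, map_zero, map_zero, add_zero])

variable {B}

theorem pathEval_mk (r : ℚ) (u v : B.poly) :
    (B.pathEval r).toAlgHom (AdjoinDt.mk u v) = (B.polyEval r).toAlgHom u := rfl

theorem pathEval_pathConst (r : ℚ) (b : B) :
    (B.pathEval r).toAlgHom (B.pathConst.toAlgHom b) = b := polyEval_polyConst r b

/-- The Poincaré lemma: a closed form which vanishes at `t = 0` has a primitive which vanishes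
at `t = 0`, namely the integral over `[0, t]`. -/
theorem exists_primitive_of_pathEval_zero {x : B.path} (hd : B.path.d x = 0)
    (h0 : (B.pathEval 0).toAlgHom x = 0) :
    ∃ y, B.path.d y = x ∧ (B.pathEval 0).toAlgHom y = 0 := by
  change AdjoinDt B.poly at x
  have h1 : signMap B.poly.grade (B.polyDeriv (AdjoinDt.fn x)) + B.poly.d (AdjoinDt.form x) = 0 :=
    congrArg AdjoinDt.form hd
  have h2 : B.poly.d (signMap B.poly.grade (AdjoinDt.form x)) = B.polyDeriv (AdjoinDt.fn x) := by
    rw [B.poly.d_signMap, eq_neg_of_add_eq_zero_right h1, map_neg, neg_neg, B.poly.signMap_signMap]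
  have h3 : (B.polyEval 0).toAlgHom (AdjoinDt.fn x) = 0 := h0
  refine ⟨AdjoinDt.mk (B.polyIntegral (signMap B.poly.grade (AdjoinDt.form x))) 0, ?_, ?_⟩
  · refine AdjoinDt.ext ?_ ?_
    · change B.poly.d (polyMap _ _) = _
      rw [← polyMap_d, h2]
      change B.polyIntegral (B.polyDeriv _) = _
      rw [polyIntegral_polyDeriv, h3, map_zero, sub_zero]
    · change signMap B.poly.grade (B.polyDeriv (B.polyIntegral _)) + B.poly.d 0 = _
      rw [polyDeriv_polyIntegral, B.poly.signMap_signMap, map_zero, add_zero]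
  · rw [pathEval_mk, polyEval_zero_polyIntegral]

end Path

theorem Hom.mapCohomology_comp {A B C : CDGA.{u}} {f : Hom A B} {g : Hom B C} {h : Hom A C}
    (hcomp : ∀ a, g.toAlgHom (f.toAlgHom a) = h.toAlgHom a) (x : A.Cohomology) :
    g.mapCohomology (f.mapCohomology x) = h.mapCohomology x := by
  obtain ⟨z, rfl⟩ := A.cohClass_surjective x
  rw [f.mapCohomology_cohClass, g.mapCohomology_cohClass, h.mapCohomology_cohClass]
  exact congrArg C.cohClass (Subtype.ext (hcomp z))

theorem Hom.mapCohomology_id (A : CDGA.{u}) (x : A.Cohomology) :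
    (Hom.id A).mapCohomology x = x := by
  obtain ⟨z, rfl⟩ := A.cohClass_surjective x
  rfl

/-- A quasi-isomorphism `f : A → B` can be replaced by a surjective one: the mapping
path object `A ×_B B[t, dt]`, formed along the evaluation at `t = 0`, projects onto `A`, and onto
`B` by evaluation at `t = 1`. -/
theorem Hom.IsQuasiIso.exists_surjective {A B : CDGA.{u}} {f : Hom A B} (hf : f.IsQuasiIso) :
    ∃ (C : CDGA.{u}) (r : Hom C A) (p : Hom C B), r.IsQuasiIso ∧ p.IsQuasiIso ∧
      Function.Surjective p.toAlgHom := by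
  let e := B.pathEval 0
  let g : Hom A B.path := ⟨B.pathConst.toAlgHom.comp f.toAlgHom,
    fun ha => B.pathConst.map_mem (f.map_mem ha), fun a =>
      (congrArg B.pathConst.toAlgHom (f.map_d a)).trans (B.pathConst.map_d _)⟩
  let i : Hom A (pullback f e) := pullbackSection f e g fun a => (pathEval_pathConst 0 _).symm
  let r : Hom (pullback f e) A := pullbackFst f e
  let p : Hom (pullback f e) B := ⟨(B.pathEval 1).toAlgHom.comp (pullbackSnd f e).toAlgHom,
    fun hx => (B.pathEval 1).map_mem ((pullbackSnd f e).map_mem hx), fun x =>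
      (congrArg (B.pathEval 1).toAlgHom ((pullbackSnd f e).map_d x)).trans
        ((B.pathEval 1).map_d _)⟩
  have hri : ∀ x, r.mapCohomology (i.mapCohomology x) = x := fun x => by
    rw [Hom.mapCohomology_comp (h := Hom.id A) (fun a => rfl), Hom.mapCohomology_id]
  have hpi : ∀ x, p.mapCohomology (i.mapCohomology x) = f.mapCohomology x := fun x =>
    Hom.mapCohomology_comp (fun a => pathEval_pathConst 1 _) x
  have hr : r.IsQuasiIso := by
    refine ⟨(injective_iff_map_eq_zero _).2 fun x hx => ?_, fun x => ⟨_, hri x⟩⟩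
    obtain ⟨z, rfl⟩ := (pullback f e).cohClass_surjective x
    obtain ⟨a, ha⟩ := A.cohClass_eq_zero.1 hx
    have ha' : A.d a = r.toAlgHom z := ha
    have hz : (pullback f e).d z = 0 := z.2
    set w : pullback f e := z - (pullback f e).d (i.toAlgHom a) with hw
    have hw1 : r.toAlgHom w = 0 := by
      rw [hw, map_sub, r.map_d, ← ha']
      exact sub_self _
    have hdw : (pullback f e).d w = 0 := by rw [hw, map_sub, hz, (pullback f e).d_d, sub_zero]
    have hw2 : e.toAlgHom ((pullbackSnd f e).toAlgHom w) = 0 := by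
      have : f.toAlgHom (r.toAlgHom w) = e.toAlgHom ((pullbackSnd f e).toAlgHom w) := w.2
      rw [← this, hw1, map_zero]
    obtain ⟨y, hy, hy0⟩ := exists_primitive_of_pathEval_zero
      (by rw [← (pullbackSnd f e).map_d, hdw, map_zero]) hw2
    refine (pullback f e).cohClass_eq_zero.2
      ⟨pullbackMk f e 0 y (by rw [map_zero]; exact hy0.symm) + i.toAlgHom a, ?_⟩
    rw [map_add, ← eq_sub_iff_add_eq]
    refine pullback_ext ?_ ?_
    · refine Eq.trans ?_ hw1.symm
      exact map_zero A.d
    · exact hy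
  refine ⟨pullback f e, r, p, hr, ?_, ?_⟩
  · have hi : Function.Surjective i.mapCohomology := fun x => ⟨r.mapCohomology x, hr.1 (hri _)⟩
    constructor
    · intro x y hxy
      obtain ⟨x, rfl⟩ := hi x
      obtain ⟨y, rfl⟩ := hi y
      rw [hpi, hpi] at hxy
      rw [hf.1 hxy]
    · intro y
      obtain ⟨x, rfl⟩ := hf.2 y
      exact ⟨_, hpi x⟩
  · intro b
    -- the path `t ↦ t b` joins `0` to `b`
    refine ⟨pullbackMk f e 0 (AdjoinDt.mk (polyTmul b Polynomial.X) 0) ?_, ?_⟩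
    · rw [map_zero]
      change 0 = (B.polyEval 0).toAlgHom (polyTmul b Polynomial.X)
      rw [polyEval_polyTmul, Polynomial.eval_X, zero_smul]
    · change (B.polyEval 1).toAlgHom (polyTmul b Polynomial.X) = b
      rw [polyEval_polyTmul, Polynomial.eval_X, one_smul]

end CDGA

/-! ### Invariance under weak equivalence -/

theorem MCProductData.productsDecompose_iff_of_weaklyEquivalent (D : MCProductData.{v})
    {A B : CDGA.{u}} (h : CDGA.WeaklyEquivalent A B) :
    D.ProductsDecompose A ↔ D.ProductsDecompose B := by
  induction h with
  | rel A B h =>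
    obtain ⟨f, hf⟩ := h
    refine ⟨fun hA => ?_, fun hB => hB.of_quasiIso hf⟩
    obtain ⟨C, r, p, hr, hp, hps⟩ := hf.exists_surjective
    exact (hA.of_quasiIso hr).of_surjective_quasiIso hp hps
  | refl A => exact Iff.rfl
  | symm A B _ ih => exact ih.symm
  | trans A B C _ _ ih ih' => exact ih.trans ih'

theorem lemma3p2 (B : CDGA.{u}) (hB : B.IsFormal) (D : MCProductData.{v})
    (x : B.Cohomology) (hx : x ∈ D.MP B) :
    ∃ (n : ℕ) (y : Fin n → B.Cohomology), (∀ k, B.IsDecomposable (y k)) ∧ x = ∑ k, y k := by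
  have hmem : x ∈ B.decomposables :=
    (D.productsDecompose_iff_of_weaklyEquivalent hB).2 (D.productsDecompose_of_d_eq_zero rfl) x hx
  obtain ⟨l, hl, rfl⟩ := AddSubmonoid.exists_list_of_mem_closure hmem
  exact ⟨l.length, l.get, fun k => hl _ (l.get_mem k), by rw [← List.sum_ofFn, List.ofFn_get]⟩
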